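/- Let $N\ge 1$ and let $X=\{X(t),t\in\mathbb{R}^N\}$ be a real-valued, centered Gaussian random field on a probability space, with $X(0)=0$ a.s. and stationary increments. Assume that $X$ has a spectral density: a nonnegative measurable function $f$ on $\mathbb{R}^N$ such that the measure $F(d\lambda)=f(\lambda)\,d\lambda$ is symmetric, $\int_{\mathbb{R}^N}\frac{|\lambda|^2}{1+|\lambda|^2}f(\lambda)\,d\lambda<\infty$ and $$\mathbb{E}[X(s)X(t)]=\int_{\mathbb{R}^N}\big(e^{i\langle s,\lambda\rangle}-1\big)\big(e^{-i\langle t,\lambda\rangle}-1\big)f(\lambda)\,d\lambda\qquad\text{for all } s,t\in\mathbb{R}^N.$$ Assume Condition (C): there are constants $c_1,c_2,c_3,\gamma>0$ and $(\beta_1,\dots,\beta_N)\in(0,\infty)^N$ with $\gamma>\sum_{j=1}^N\frac1{\beta_j}$ such that $$\frac{c_1}{\big(\sum_{j=1}^N|\lambda_j|^{\beta_j}\big)^{\gamma}}\le f(\lambda)\le\frac{c_2}{\big(\sum_{j=1}^N|\lambda_j|^{\beta_j}\big)^{\gamma}}\qquad\text{for all }\lambda\in\mathbb{R}^N\text{ with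 }|\lambda|\ge c_3.$$ Put $H_j=\frac{\beta_j}{2}\big(\gamma-\sum_{i=1}^N\frac1{\beta_i}\big)$. A version of $X$ is a random field $\widetilde X$ on the same probability space with $\widetilde X(t)=X(t)$ a.s. for every $t\in\mathbb{R}^N$. (i) If $H_j>1$ for some $j\in\{1,\dots,N\}$, then $X$ has a version $\widetilde X$ with continuous sample functions such that, almost surely, the $j$-th partial derivative $\widetilde X'_j(t)$ exists at every $t\in\mathbb{R}^N$ and $t\mapsto\widetilde X'_j(t)$ is continuous. (ii) If $H_j>1$ for all $j\in\{1,\dots,N\}$, then $X$ has a version $\widetilde X$ such that, almost surely, $t\mapsto\widetilde X(t)$ is continuously differentiable on $\mathbb{R}^N$ and, with $\nabla\widetilde X(t)=(\widetilde X'_1(t),\dots,\widetilde X'_N(t))$, $$\lim_{h\to0}\frac{\widetilde X(t+hu)-\widetilde X(t)-h\,u^{T}\nabla\widetilde X(t)}{h}=0\qquad\text{for all } u\in\mathbb{R}^N\text{ with }|u|=1\text{ and all }t\in\mathbb{R}^N.$$ -/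

import Mathlib

open MeasureTheory ProbabilityTheory Filter Topology

namespace AnisotropicField

noncomputable section

/-- A field has stationary increments: for every shift `h`, the fields
`t ↦ X (t + h) - X h` and `t ↦ X t - X 0` have the same finite-dimensional distributions. -/
def HasStationaryIncrements {N : ℕ} {Ω : Type*} [MeasurableSpace Ω]
    (X : EuclideanSpace ℝ (Fin N) → Ω → ℝ) (μ : Measure Ω) : Prop :=
  ∀ (h : EuclideanSpace ℝ (Fin N)) (S : Finset (EuclideanSpace ℝ (Fin N))),
    μ.map (fun ω (t : S) => X ((t : EuclideanSpace ℝ (Fin N)) + h) ω - X h ω) =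
      μ.map (fun ω (t : S) => X (t : EuclideanSpace ℝ (Fin N)) ω - X 0 ω)

/-- `F` is the spectral measure (on `ℝ^N ∖ {0}`, hence without mass at the origin) of the
centered field `X`: it is symmetric, integrates `|x|² / (1 + |x|²)`, and represents the
covariance `E[X(s) X(t)]` of `X` (without linear term). -/
structure IsSpectralMeasure {N : ℕ} {Ω : Type*} [MeasurableSpace Ω]
    (X : EuclideanSpace ℝ (Fin N) → Ω → ℝ) (μ : Measure Ω)
    (F : Measure (EuclideanSpace ℝ (Fin N))) : Prop where
  zero_mass : F {0} = 0
  symmetric : F.map (fun x => -x) = F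
  finite : ∫⁻ x, ENNReal.ofReal (‖x‖ ^ 2 / (1 + ‖x‖ ^ 2)) ∂F < ⊤
  covariance : ∀ s t : EuclideanSpace ℝ (Fin N),
    ((∫ ω, X s ω * X t ω ∂μ : ℝ) : ℂ) =
      ∫ x, (Complex.exp (Complex.I * (inner ℝ s x : ℝ)) - 1) *
        (Complex.exp (-(Complex.I * (inner ℝ t x : ℝ))) - 1) ∂F

/-- `f` is the spectral density of `X`: a nonnegative measurable density of its spectral
measure with respect to Lebesgue measure. -/
structure HasSpectralDensity {N : ℕ} {Ω : Type*} [MeasurableSpace Ω]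
    (X : EuclideanSpace ℝ (Fin N) → Ω → ℝ) (μ : Measure Ω)
    (f : EuclideanSpace ℝ (Fin N) → ℝ) : Prop where
  measurable : Measurable f
  nonneg : ∀ x, 0 ≤ f x
  spectral : IsSpectralMeasure X μ (volume.withDensity fun x => ENNReal.ofReal (f x))

/-- Condition (C) on a spectral density `f`, with exponents `γ` and `β`. -/
structure ConditionC {N : ℕ} (f : EuclideanSpace ℝ (Fin N) → ℝ) (γ : ℝ) (β : Fin N → ℝ) :
    Prop where
  gamma_pos : 0 < γ
  beta_pos : ∀ j, 0 < β j
  gamma_gt : ∑ j, 1 / β j < γ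
  bounds : ∃ c₁ c₂ c₃ : ℝ, 0 < c₁ ∧ 0 < c₂ ∧ 0 < c₃ ∧
    ∀ x : EuclideanSpace ℝ (Fin N), c₃ ≤ ‖x‖ →
      c₁ / (∑ j, |x j| ^ β j) ^ γ ≤ f x ∧ f x ≤ c₂ / (∑ j, |x j| ^ β j) ^ γ

/-- The index `H_j = (β_j / 2) (γ - ∑ i, 1 / β_i)`. -/
def smoothnessIndex {N : ℕ} (γ : ℝ) (β : Fin N → ℝ) (j : Fin N) : ℝ :=
  β j / 2 * (γ - ∑ i, 1 / β i)

/-- The random field `Y` is a version (modification) of `X`. -/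
def IsVersion {N : ℕ} {Ω : Type*} [MeasurableSpace Ω]
    (Y X : EuclideanSpace ℝ (Fin N) → Ω → ℝ) (μ : Measure Ω) : Prop :=
  (∀ t, Measurable (Y t)) ∧ ∀ t, ∀ᵐ ω ∂μ, Y t ω = X t ω

/-- Existence of the `j`-th partial derivative of `g` at `t`. -/
def HasPartial {N : ℕ} (g : EuclideanSpace ℝ (Fin N) → ℝ) (j : Fin N)
    (t : EuclideanSpace ℝ (Fin N)) : Prop :=
  LineDifferentiableAt ℝ g t (EuclideanSpace.single j (1 : ℝ))

/-- The `j`-th partial derivative of `g` at `t`. -/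
def partialDeriv {N : ℕ} (g : EuclideanSpace ℝ (Fin N) → ℝ) (j : Fin N)
    (t : EuclideanSpace ℝ (Fin N)) : ℝ :=
  lineDeriv ℝ g t (EuclideanSpace.single j (1 : ℝ))

/-- The vector of first-order partial derivatives of `g` at `t`. -/
def grad {N : ℕ} (g : EuclideanSpace ℝ (Fin N) → ℝ) (t : EuclideanSpace ℝ (Fin N)) :
    EuclideanSpace ℝ (Fin N) :=
  WithLp.toLp 2 fun j => partialDeriv g j t

end

end AnisotropicField

/-! The covariance formula is an isometry: a linear combination of values of `X` has the variance of
the same combination of the kernels `e^{i⟨t,x⟩} - 1` in `L²(F)`. A variance bound therefore follows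
from a pointwise bound on an exponential sum by a weight that is square integrable for `F`
(`IsSpectralMeasure.integral_sum_sq_le`). By Condition (C), powers of the gauge `S(x) = ∑
|x_j|^{β_j}` with exponent below `γ - ∑ 1/β_j` are integrable at high frequencies. Since `|x_j|² ≤
S^{2/β_j}`, the inequality `H_j > 1`, i.e. `2/β_j < γ - ∑ 1/β_i`, leaves room for the weight `(|x_j|
‖x‖^a)²` with some small `a > 0`.

This weight controls the difference quotients `(X(t + h e_j) - X(t)) / h`, viewed as one Gaussian
field in `(t, h)`, `h ≠ 0`: their kernels are averages of `i x_j e^{i⟨·,x⟩}`, so increments in `(t,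
h)` have standard deviation at most a constant times `dist^a`, with no loss as `h → 0`. Gaussian
moments and Kolmogorov's criterion give a field `W` continuous on all of `ℝ^N × ℝ`, including `h =
0`. For a continuous version `Y`, the identity `Y(t + h e_j) - Y(t) = h W(t, h)` holds a.s. on a
countable dense set, hence everywhere by continuity. So `W(t, 0)` is the partial derivative at every
`t` simultaneously, and it is continuous (`ae_exists_hasContinuousQuotient`). When this holds in all
directions, changing one coordinate at a time gives `C¹` paths. -/

namespace AnisotropicField

/-! ### Dyadic grids and deterministic chaining. -/

noncomputable section

/-- The point of the dyadic grid of mesh `2⁻ⁿ` with integer coordinates `k`. -/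
def gridPoint {d : ℕ} (n : ℕ) (k : Fin d → ℤ) : Fin d → ℝ := fun i => (k i : ℝ) / 2 ^ n

/-- The integer coordinates of the corner of the dyadic cube of mesh `2⁻ⁿ` containing `x`. -/
def gridFloor {d : ℕ} (n : ℕ) (x : Fin d → ℝ) : Fin d → ℤ := fun i => ⌊2 ^ n * x i⌋

/-- The integer points of the cube `[-m 2ⁿ, m 2ⁿ]^d`. -/
def gridBox (d m n : ℕ) : Finset (Fin d → ℤ) :=
  Fintype.piFinset fun _ => Finset.Icc (-(m * 2 ^ n : ℤ)) (m * 2 ^ n)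

/-- The vectors with coordinates in `{-1, 0, 1}`. -/
def unitSteps (d : ℕ) : Finset (Fin d → ℤ) := Fintype.piFinset fun _ => Finset.Icc (-1) 1

lemma card_gridBox_le (d m n : ℕ) :
    (gridBox d m n).card ≤ (2 * m + 1) ^ d * (2 ^ n) ^ d := by
  rw [gridBox, Fintype.card_piFinset_const, ← mul_pow]
  refine Nat.pow_le_pow_left ?_ _
  have h1 : (1 : ℤ) ≤ 2 ^ n := one_le_pow₀ (by norm_num)
  have h2 : (Finset.Icc (-(m * 2 ^ n : ℤ)) (m * 2 ^ n)).card
      = (m * 2 ^ n + 1 - -(m * 2 ^ n : ℤ)).toNat := Int.card_Icc _ _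
  rw [h2, Int.toNat_le]
  push_cast
  nlinarith

lemma card_unitSteps (d : ℕ) : (unitSteps d).card = 3 ^ d := by
  simp [unitSteps]

lemma dist_gridPoint_add_le {d : ℕ} (n : ℕ) (k e : Fin d → ℤ) (he : e ∈ unitSteps d) :
    dist (gridPoint n k) (gridPoint n (k + e)) ≤ (2⁻¹ : ℝ) ^ n := by
  refine (dist_pi_le_iff (by positivity)).2 fun i => ?_
  have hi := (Fintype.mem_piFinset.1 he) i
  rw [Finset.mem_Icc] at hi
  have h1 : |(e i : ℝ)| ≤ 1 := by
    rw [abs_le]; exact ⟨by exact_mod_cast hi.1, by exact_mod_cast hi.2⟩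
  have : (k i : ℝ) / 2 ^ n - ((k + e) i : ℤ) / 2 ^ n = -(e i : ℝ) / 2 ^ n := by
    simp only [Pi.add_apply]; push_cast; ring
  rw [Real.dist_eq, gridPoint, gridPoint, this, abs_div, abs_neg, inv_pow, abs_of_pos (by positivity : (0:ℝ) < 2 ^ n),
    div_eq_mul_inv]
  exact mul_le_of_le_one_left (by positivity) h1

lemma gridFloor_mem_gridBox {d : ℕ} {m : ℕ} {x : Fin d → ℝ} (hx : ‖x‖ ≤ m) (n : ℕ) :
    gridFloor n x ∈ gridBox d m n := by
  refine Fintype.mem_piFinset.2 fun i => Finset.mem_Icc.2 ?_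
  have hi := abs_le.1 ((norm_le_pi_norm x i).trans hx)
  have h2 : (0 : ℝ) < 2 ^ n := by positivity
  constructor
  · refine Int.le_floor.2 ?_
    push_cast
    nlinarith
  · refine (Int.cast_le (R := ℝ)).1 ((Int.floor_le _).trans ?_)
    push_cast
    nlinarith

lemma gridFloor_sub_mem_unitSteps {d : ℕ} {x y : Fin d → ℝ} {n : ℕ}
    (h : dist x y ≤ (2⁻¹ : ℝ) ^ n) : gridFloor n y - gridFloor n x ∈ unitSteps d := by
  refine Fintype.mem_piFinset.2 fun i => Finset.mem_Icc.2 ?_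
  have hi := abs_le.1 ((dist_le_pi_dist x y i).trans h)
  have h2 : (0 : ℝ) < 2 ^ n := by positivity
  rw [inv_pow] at hi
  have e1 : 2 ^ n * x i ≤ 2 ^ n * y i + 1 := by
    have := mul_le_mul_of_nonneg_left hi.2 h2.le
    rw [mul_inv_cancel₀ h2.ne'] at this
    linarith
  have e2 : 2 ^ n * y i ≤ 2 ^ n * x i + 1 := by
    have := mul_le_mul_of_nonneg_left hi.1 h2.le
    rw [mul_neg, mul_inv_cancel₀ h2.ne'] at this
    linarith
  have f1 := Int.floor_mono e1
  have f2 := Int.floor_mono e2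
  rw [Int.floor_add_one] at f1 f2
  simp only [Pi.sub_apply, gridFloor]
  omega

/-- Links consecutive levels of the chain: the level `n` corner, rewritten on the finer grid,
neighbours the level `n + 1` corner. -/
lemma two_mul_gridFloor_sub_mem_unitSteps {d : ℕ} (x : Fin d → ℝ) (n : ℕ) :
    (fun i => 2 * gridFloor n x i) - gridFloor (n + 1) x ∈ unitSteps d := by
  refine Fintype.mem_piFinset.2 fun i => Finset.mem_Icc.2 ?_
  have e : (2 : ℝ) ^ (n + 1) * x i = 2 * (2 ^ n * x i) := by ring
  simp only [Pi.sub_apply, gridFloor, e]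
  have h1 := Int.floor_le (2 ^ n * x i)
  have h2 := Int.lt_floor_add_one (2 ^ n * x i)
  have h3 : 2 * ⌊2 ^ n * x i⌋ ≤ ⌊2 * (2 ^ n * x i)⌋ := by
    refine Int.le_floor.2 ?_; push_cast; linarith
  have h4 : ⌊2 * (2 ^ n * x i)⌋ < 2 * ⌊2 ^ n * x i⌋ + 2 := by
    refine Int.floor_lt.2 ?_; push_cast; linarith
  omega

lemma gridPoint_succ_two_mul {d : ℕ} (n : ℕ) (k : Fin d → ℤ) :
    gridPoint (n + 1) (fun i => 2 * k i) = gridPoint n k := by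
  ext i
  simp only [gridPoint, pow_succ]
  push_cast
  field_simp

lemma dist_gridPoint_gridFloor_le {d : ℕ} (n : ℕ) (x : Fin d → ℝ) :
    dist (gridPoint n (gridFloor n x)) x ≤ (2⁻¹ : ℝ) ^ n := by
  refine (dist_pi_le_iff (by positivity)).2 fun i => ?_
  have h1 := Int.floor_le (2 ^ n * x i)
  have h2 := Int.lt_floor_add_one (2 ^ n * x i)
  have h3 : (0 : ℝ) < 2 ^ n := by positivity
  have : (gridPoint n (gridFloor n x)) i - x i = (⌊2 ^ n * x i⌋ - 2 ^ n * x i) / 2 ^ n := by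
    simp only [gridPoint, gridFloor]; field_simp
  rw [Real.dist_eq, this, abs_div, abs_of_pos h3, inv_pow, div_eq_mul_inv]
  refine mul_le_of_le_one_left (by positivity) ?_
  rw [abs_le]; constructor <;> linarith

/-- A function on the dyadic points whose increments between neighbours decay geometrically on
every box converges along dyadic approximations, and the limit is continuous. -/
lemma exists_continuous_of_dyadic_increments {d : ℕ} (v : (Fin d → ℝ) → ℝ) {q : ℝ} (hq0 : 0 < q)
    (hq1 : q < 1)
    (h : ∀ m : ℕ, ∃ K : ℝ, ∀ n, ∀ k ∈ gridBox d m n, ∀ e ∈ unitSteps d,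
      |v (gridPoint n k) - v (gridPoint n (k + e))| ≤ K * q ^ n) :
    ∃ w : (Fin d → ℝ) → ℝ, Continuous w ∧
      ∀ x, Tendsto (fun n => v (gridPoint n (gridFloor n x))) atTop (𝓝 (w x)) := by
  choose K hK using h
  have hK0 : ∀ m, 0 ≤ K m := fun m => by
    have := hK m 0 0 (Fintype.mem_piFinset.2 fun i => by simp)
      0 (Fintype.mem_piFinset.2 fun i => by simp)
    simpa using (abs_nonneg _).trans this
  have hstep : ∀ (m : ℕ) (x : Fin d → ℝ), ‖x‖ ≤ m → ∀ n,
      dist (v (gridPoint n (gridFloor n x))) (v (gridPoint (n + 1) (gridFloor (n + 1) x)))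
        ≤ K m * q ^ n := by
    intro m x hx n
    have := hK m (n + 1) _ (gridFloor_mem_gridBox hx (n + 1)) _
      (two_mul_gridFloor_sub_mem_unitSteps x n)
    rw [add_sub_cancel, gridPoint_succ_two_mul] at this
    rw [dist_comm, Real.dist_eq]
    refine this.trans (mul_le_mul_of_nonneg_left ?_ (hK0 m))
    exact pow_le_pow_of_le_one hq0.le hq1.le (Nat.le_succ n)
  have hlim : ∀ x : Fin d → ℝ, ∃ a,
      Tendsto (fun n => v (gridPoint n (gridFloor n x))) atTop (𝓝 a) := by
    intro x
    obtain ⟨m, hm⟩ := exists_nat_ge ‖x‖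
    exact cauchySeq_tendsto_of_complete (cauchySeq_of_le_geometric q (K m) hq1 (hstep m x hm))
  choose w hw using hlim
  refine ⟨w, ?_, hw⟩
  rw [continuous_iff_continuousAt]
  intro x
  -- The margin `1` keeps every `y` within distance `1` of `x` in the same box, so that one constant
  -- `K m` serves both points.
  obtain ⟨m, hm⟩ := exists_nat_ge (‖x‖ + 1)
  -- Compare `w y` and `w x` through their level `n` corners: two geometric tails and one increment
  -- between neighbours.
  have key : ∀ (y : Fin d → ℝ) (n : ℕ), dist y x ≤ (2⁻¹ : ℝ) ^ n →
      dist (w y) (w x) ≤ (K m * (1 + 2 / (1 - q))) * q ^ n := by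
    intro y n hy
    have hxm : ‖x‖ ≤ m := by linarith
    have hym : ‖y‖ ≤ m := by
      have h1 : ‖y‖ ≤ ‖x‖ + dist y x := by
        rw [dist_eq_norm]; simpa using norm_add_le x (y - x)
      have h2 : (2⁻¹ : ℝ) ^ n ≤ 1 := pow_le_one₀ (by norm_num) (by norm_num)
      linarith
    have a1 := dist_le_of_le_geometric_of_tendsto q (K m) hq1 (hstep m x hxm) (hw x) n
    have a2 := dist_le_of_le_geometric_of_tendsto q (K m) hq1 (hstep m y hym) (hw y) n
    have a3 := hK m n _ (gridFloor_mem_gridBox hym n) _ (gridFloor_sub_mem_unitSteps hy)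
    rw [add_sub_cancel, ← Real.dist_eq] at a3
    have a4 := dist_triangle4 (w y) (v (gridPoint n (gridFloor n y)))
      (v (gridPoint n (gridFloor n x))) (w x)
    rw [dist_comm] at a2
    have : (K m * (1 + 2 / (1 - q))) * q ^ n
      = K m * q ^ n / (1 - q) + K m * q ^ n + K m * q ^ n / (1 - q) := by ring
    linarith
  rw [Metric.continuousAt_iff]
  intro ε hε
  have hT : Tendsto (fun n : ℕ => (K m * (1 + 2 / (1 - q))) * q ^ n) atTop (𝓝 0) := by
    simpa using (tendsto_pow_atTop_nhds_zero_of_lt_one hq0.le hq1).const_mul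
      (K m * (1 + 2 / (1 - q)))
  obtain ⟨n, hn⟩ := (hT.eventually (gt_mem_nhds hε)).exists
  exact ⟨(2⁻¹ : ℝ) ^ n, by positivity, fun {y} hy => (key y n hy.le).trans_lt hn⟩

end

/-! ### Kolmogorov's continuity criterion, general and Gaussian. -/

noncomputable section

open scoped ENNReal NNReal

/-- The sum of the `p`-th powers of the increments of `V` between neighbouring dyadic points of
mesh `2⁻ⁿ` in the cube `[-m, m]^d`. -/
def gridVariation {d : ℕ} {Ω : Type*} (V : (Fin d → ℝ) → Ω → ℝ) (p m n : ℕ) (ω : Ω) : ℝ≥0∞ :=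
  ∑ k ∈ gridBox d m n, ∑ e ∈ unitSteps d,
    ‖V (gridPoint n k) ω - V (gridPoint n (k + e)) ω‖ₑ ^ p

lemma ofReal_le_inv_two_pow {x : ℝ} {n : ℕ} (h : x ≤ (2⁻¹ : ℝ) ^ n) :
    ENNReal.ofReal x ≤ ((2⁻¹ : ℝ≥0) : ℝ≥0∞) ^ n := by
  rw [← ENNReal.coe_pow, ← ENNReal.ofReal_coe_nnreal]
  refine ENNReal.ofReal_le_ofReal (h.trans (le_of_eq ?_))
  push_cast
  rfl

/-- Each weighted increment is a single term of the convergent sum; the weight `(3/2)^n` becomes the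
decay rate `(2/3)^{1/p}` after taking `p`-th roots. -/
lemma abs_increment_le_of_tsum_gridVariation {d : ℕ} {Ω : Type*} {V : (Fin d → ℝ) → Ω → ℝ} {p : ℕ} (hp : p ≠ 0)
    {m : ℕ} {ω : Ω}
    (h : ∑' n, ((3 / 2 : ℝ≥0) : ℝ≥0∞) ^ n * gridVariation V p m n ω < ∞) :
    ∃ K : ℝ, ∀ n, ∀ k ∈ gridBox d m n, ∀ e ∈ unitSteps d,
      |V (gridPoint n k) ω - V (gridPoint n (k + e)) ω| ≤ K * ((2 / 3 : ℝ) ^ (p : ℝ)⁻¹) ^ n := by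
  set S := ∑' n, ((3 / 2 : ℝ≥0) : ℝ≥0∞) ^ n * gridVariation V p m n ω
  refine ⟨S.toReal ^ (p : ℝ)⁻¹, fun n k hk e he => ?_⟩
  have h1 : ((3 / 2 : ℝ≥0) : ℝ≥0∞) ^ n * ‖V (gridPoint n k) ω - V (gridPoint n (k + e)) ω‖ₑ ^ p
      ≤ S := by
    refine le_trans (mul_le_mul_right ?_ _) (ENNReal.le_tsum n)
    refine le_trans ?_ (Finset.single_le_sum (f := fun k => ∑ e ∈ unitSteps d,
      ‖V (gridPoint n k) ω - V (gridPoint n (k + e)) ω‖ₑ ^ p) (fun _ _ => zero_le) hk)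
    exact Finset.single_le_sum (f := fun e =>
      ‖V (gridPoint n k) ω - V (gridPoint n (k + e)) ω‖ₑ ^ p) (fun _ _ => zero_le) he
  have h2 := ENNReal.toReal_mono h.ne h1
  rw [ENNReal.toReal_mul, ENNReal.toReal_pow, ENNReal.toReal_pow, toReal_enorm, Real.norm_eq_abs,
    ENNReal.coe_toReal] at h2
  push_cast at h2
  refine (pow_le_pow_iff_left₀ (abs_nonneg _) (by positivity) hp).1 ?_
  rw [mul_pow, Real.rpow_inv_natCast_pow ENNReal.toReal_nonneg hp, pow_right_comm,
    Real.rpow_inv_natCast_pow (by norm_num) hp]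
  calc |V (gridPoint n k) ω - V (gridPoint n (k + e)) ω| ^ p
      = ((3 / 2) ^ n * |V (gridPoint n k) ω - V (gridPoint n (k + e)) ω| ^ p) * (2 / 3) ^ n := by
        rw [mul_right_comm, ← mul_pow]; norm_num
    _ ≤ _ := mul_le_mul_of_nonneg_right h2 (by positivity)

variable {d : ℕ} {Ω : Type*} [MeasurableSpace Ω] {μ : Measure Ω}

lemma measurable_gridVariation {V : (Fin d → ℝ) → Ω → ℝ} (hV : ∀ x, Measurable (V x))
    (p m n : ℕ) : Measurable (gridVariation V p m n) := by
  unfold gridVariation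
  refine Finset.measurable_fun_sum _ fun k _ => Finset.measurable_fun_sum _ fun e _ => ?_
  exact (((hV _).sub (hV _)).enorm).pow_const p

/-- There are of order `2^{nd}` pairs of neighbours, each contributing at most `C 2^{-n(d+1)}`; the
extra power in the moment bound leaves `2^{-n}`. -/
lemma lintegral_gridVariation_le {V : (Fin d → ℝ) → Ω → ℝ} (hV : ∀ x, Measurable (V x))
    {A : Set (Fin d → ℝ)} (hA : ∀ n k, gridPoint n k ∈ A) {p : ℕ} {C : ℝ≥0∞}
    (hinc : ∀ x ∈ A, ∀ y ∈ A, dist x y ≤ 1 →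
      ∫⁻ ω, ‖V x ω - V y ω‖ₑ ^ p ∂μ ≤ C * ENNReal.ofReal (dist x y) ^ (d + 1)) (m n : ℕ) :
    ∫⁻ ω, gridVariation V p m n ω ∂μ
      ≤ ((2 * m + 1) ^ d * 3 ^ d * C) * ((2⁻¹ : ℝ≥0) : ℝ≥0∞) ^ n := by
  have hm : ∀ k e : Fin d → ℤ, Measurable fun ω =>
      ‖V (gridPoint n k) ω - V (gridPoint n (k + e)) ω‖ₑ ^ p := fun k e =>
    (((hV _).sub (hV _)).enorm).pow_const p
  have hterm : ∀ k, ∀ e ∈ unitSteps d,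
      ∫⁻ ω, ‖V (gridPoint n k) ω - V (gridPoint n (k + e)) ω‖ₑ ^ p ∂μ
        ≤ C * (((2⁻¹ : ℝ≥0) : ℝ≥0∞) ^ n) ^ (d + 1) := by
    intro k e he
    have h1 := dist_gridPoint_add_le n k e he
    refine (hinc _ (hA _ _) _ (hA _ _) (h1.trans (pow_le_one₀ (by norm_num) (by norm_num)))).trans ?_
    gcongr
    exact ofReal_le_inv_two_pow h1
  calc ∫⁻ ω, gridVariation V p m n ω ∂μ
      = ∑ k ∈ gridBox d m n, ∑ e ∈ unitSteps d,
        ∫⁻ ω, ‖V (gridPoint n k) ω - V (gridPoint n (k + e)) ω‖ₑ ^ p ∂μ := by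
        unfold gridVariation
        rw [lintegral_finsetSum _ fun k _ => Finset.measurable_fun_sum _ fun e _ => hm k e]
        exact Finset.sum_congr rfl fun k _ => lintegral_finsetSum _ fun e _ => hm k e
    _ ≤ ∑ k ∈ gridBox d m n, ∑ e ∈ unitSteps d,
        C * (((2⁻¹ : ℝ≥0) : ℝ≥0∞) ^ n) ^ (d + 1) :=
        Finset.sum_le_sum fun k _ => Finset.sum_le_sum fun e he => hterm k e he
    _ = ((gridBox d m n).card : ℝ≥0∞) * (3 ^ d * (C * (((2⁻¹ : ℝ≥0) : ℝ≥0∞) ^ n) ^ (d + 1))) := by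
        simp [card_unitSteps]
    _ ≤ (((2 * m + 1) ^ d * (2 ^ n) ^ d : ℕ) : ℝ≥0∞)
        * (3 ^ d * (C * (((2⁻¹ : ℝ≥0) : ℝ≥0∞) ^ n) ^ (d + 1))) := by
        gcongr
        exact card_gridBox_le d m n
    _ = ((2 * m + 1) ^ d * 3 ^ d * C) * ((2⁻¹ : ℝ≥0) : ℝ≥0∞) ^ n
        * ((2 ^ n * ((2⁻¹ : ℝ≥0) : ℝ≥0∞) ^ n) ^ d) := by
        push_cast
        ring
    _ = _ := by
        have : (2 : ℝ≥0∞) ^ n * ((2⁻¹ : ℝ≥0) : ℝ≥0∞) ^ n = 1 := by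
          rw [← mul_pow]
          have : (2 : ℝ≥0∞) * ((2⁻¹ : ℝ≥0) : ℝ≥0∞) = 1 := by
            rw [ENNReal.coe_inv (by norm_num)]
            exact ENNReal.mul_inv_cancel (by norm_num) (by norm_num)
          rw [this, one_pow]
        rw [this, one_pow, mul_one]

/-- The weight `3/2` exceeds `1`, to force decay of increments, but stays below `2`, so the expected
sum is dominated by a geometric series of ratio `3/4`. -/
lemma ae_tsum_gridVariation_lt_top {V : (Fin d → ℝ) → Ω → ℝ} (hV : ∀ x, Measurable (V x))
    {A : Set (Fin d → ℝ)} (hA : ∀ n k, gridPoint n k ∈ A) {p : ℕ} {C : ℝ≥0∞} (hC : C ≠ ∞)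
    (hinc : ∀ x ∈ A, ∀ y ∈ A, dist x y ≤ 1 →
      ∫⁻ ω, ‖V x ω - V y ω‖ₑ ^ p ∂μ ≤ C * ENNReal.ofReal (dist x y) ^ (d + 1)) (m : ℕ) :
    ∀ᵐ ω ∂μ, ∑' n, ((3 / 2 : ℝ≥0) : ℝ≥0∞) ^ n * gridVariation V p m n ω < ∞ := by
  have hm : ∀ n, Measurable fun ω => ((3 / 2 : ℝ≥0) : ℝ≥0∞) ^ n * gridVariation V p m n ω :=
    fun n => (measurable_gridVariation hV p m n).const_mul _
  refine ae_lt_top (Measurable.tsum hm) (ne_of_lt ?_)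
  rw [lintegral_tsum fun n => (hm n).aemeasurable]
  set B : ℝ≥0∞ := (2 * m + 1) ^ d * 3 ^ d * C
  have hB : B ≠ ∞ := by
    refine ENNReal.mul_ne_top (ENNReal.mul_ne_top (ENNReal.pow_ne_top ?_)
      (ENNReal.pow_ne_top (by norm_num))) hC
    exact ENNReal.add_ne_top.2 ⟨ENNReal.mul_ne_top (by norm_num) (ENNReal.natCast_ne_top m),
      by norm_num⟩
  calc ∑' n, ∫⁻ ω, ((3 / 2 : ℝ≥0) : ℝ≥0∞) ^ n * gridVariation V p m n ω ∂μ
      ≤ ∑' n, B * ((3 / 4 : ℝ≥0) : ℝ≥0∞) ^ n := by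
        refine ENNReal.tsum_le_tsum fun n => ?_
        rw [lintegral_const_mul _ (measurable_gridVariation hV p m n)]
        refine (mul_le_mul_right (lintegral_gridVariation_le hV hA hinc m n) _).trans
          (le_of_eq ?_)
        have h34 : ((3 / 2 : ℝ≥0) : ℝ≥0∞) * ((2⁻¹ : ℝ≥0) : ℝ≥0∞) = ((3 / 4 : ℝ≥0) : ℝ≥0∞) := by
          rw [← ENNReal.coe_mul]
          congr 1
          apply NNReal.eq
          push_cast
          norm_num
        rw [mul_left_comm, ← mul_pow ((3 / 2 : ℝ≥0) : ℝ≥0∞), h34]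
    _ = B * (1 - ((3 / 4 : ℝ≥0) : ℝ≥0∞))⁻¹ := by
        rw [ENNReal.tsum_mul_left, ENNReal.tsum_geometric]
    _ < ∞ := by
        refine ENNReal.mul_lt_top hB.lt_top (ENNReal.inv_lt_top.2 ?_)
        rw [tsub_pos_iff_lt, ENNReal.coe_lt_one_iff, ← NNReal.coe_lt_coe]
        push_cast
        norm_num

/-- The `p`-th moments of the errors are summable, so the errors tend to zero a.s.; a single power
of the distance suffices here. -/
lemma ae_tendsto_gridFloor {V : (Fin d → ℝ) → Ω → ℝ} (hV : ∀ x, Measurable (V x))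
    {A : Set (Fin d → ℝ)} (hA : ∀ n k, gridPoint n k ∈ A) {p : ℕ} (hp : p ≠ 0) {C : ℝ≥0∞}
    (hC : C ≠ ∞)
    (hinc : ∀ x ∈ A, ∀ y ∈ A, dist x y ≤ 1 →
      ∫⁻ ω, ‖V x ω - V y ω‖ₑ ^ p ∂μ ≤ C * ENNReal.ofReal (dist x y) ^ (d + 1))
    {x : Fin d → ℝ} (hx : x ∈ A) :
    ∀ᵐ ω ∂μ, Tendsto (fun n => V (gridPoint n (gridFloor n x)) ω) atTop (𝓝 (V x ω)) := by
  have hm : ∀ n, Measurable fun ω => ‖V (gridPoint n (gridFloor n x)) ω - V x ω‖ₑ ^ p :=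
    fun n => (((hV _).sub (hV _)).enorm).pow_const p
  have hfin : ∀ᵐ ω ∂μ, ∑' n, ‖V (gridPoint n (gridFloor n x)) ω - V x ω‖ₑ ^ p < ∞ := by
    refine ae_lt_top (Measurable.tsum hm) (ne_of_lt ?_)
    rw [lintegral_tsum fun n => (hm n).aemeasurable]
    calc ∑' n, ∫⁻ ω, ‖V (gridPoint n (gridFloor n x)) ω - V x ω‖ₑ ^ p ∂μ
        ≤ ∑' n : ℕ, C * ((2⁻¹ : ℝ≥0) : ℝ≥0∞) ^ n := by
          refine ENNReal.tsum_le_tsum fun n => ?_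
          have h1 := dist_gridPoint_gridFloor_le n x
          have h2 : dist (gridPoint n (gridFloor n x)) x ≤ 1 :=
            h1.trans (pow_le_one₀ (by norm_num) (by norm_num))
          refine (hinc _ (hA _ _) _ hx h2).trans ?_
          refine mul_le_mul_right ?_ C
          calc ENNReal.ofReal (dist (gridPoint n (gridFloor n x)) x) ^ (d + 1)
              ≤ ENNReal.ofReal (dist (gridPoint n (gridFloor n x)) x) :=
                pow_le_of_le_one zero_le (by simpa using h2) (Nat.succ_ne_zero d)
            _ ≤ _ := ofReal_le_inv_two_pow h1
      _ = C * (1 - ((2⁻¹ : ℝ≥0) : ℝ≥0∞))⁻¹ := by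
          rw [ENNReal.tsum_mul_left, ENNReal.tsum_geometric]
      _ < ∞ := by
          refine ENNReal.mul_lt_top hC.lt_top (ENNReal.inv_lt_top.2 ?_)
          rw [tsub_pos_iff_lt, ENNReal.coe_lt_one_iff, ← NNReal.coe_lt_coe]
          push_cast
          norm_num
  filter_upwards [hfin] with ω hω
  have h1 := ENNReal.tendsto_atTop_zero_of_tsum_ne_top hω.ne
  have h2 := h1.ennrpow_const (p : ℝ)⁻¹
  rw [tendsto_iff_edist_tendsto_0]
  have h3 : (0 : ℝ≥0∞) ^ (p : ℝ)⁻¹ = 0 := ENNReal.zero_rpow_of_pos (by positivity)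
  rw [h3] at h2
  refine h2.congr fun n => ?_
  rw [← ENNReal.rpow_natCast, ENNReal.rpow_rpow_inv (by exact_mod_cast hp), edist_eq_enorm_sub]

lemma exists_continuous_modification_of_measurable {V : (Fin d → ℝ) → Ω → ℝ}
    (hV : ∀ x, Measurable (V x))
    {A : Set (Fin d → ℝ)} (hA : ∀ n k, gridPoint n k ∈ A) {p : ℕ} (hp : p ≠ 0) {C : ℝ≥0∞}
    (hC : C ≠ ∞)
    (hinc : ∀ x ∈ A, ∀ y ∈ A, dist x y ≤ 1 →
      ∫⁻ ω, ‖V x ω - V y ω‖ₑ ^ p ∂μ ≤ C * ENNReal.ofReal (dist x y) ^ (d + 1)) :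
    ∃ W : (Fin d → ℝ) → Ω → ℝ, (∀ x, Measurable (W x)) ∧ (∀ ω, Continuous fun x => W x ω) ∧
      ∀ x ∈ A, W x =ᵐ[μ] V x := by
  classical
  set G : Set Ω :=
    {ω | ∀ m, ∑' n, ((3 / 2 : ℝ≥0) : ℝ≥0∞) ^ n * gridVariation V p m n ω < ∞} with hG
  have hGm : MeasurableSet G := by
    rw [hG, Set.ofPred_forall]
    exact MeasurableSet.iInter fun m => measurableSet_lt (Measurable.tsum fun n =>
      (measurable_gridVariation hV p m n).const_mul _) measurable_const
  have hGae : ∀ᵐ ω ∂μ, ω ∈ G :=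
    ae_all_iff.2 fun m => ae_tsum_gridVariation_lt_top hV hA hC hinc m
  -- Paths outside the good event are replaced by zero, which makes every path continuous and
  -- presents the limit as one of measurable functions.
  have hex : ∀ ω, ∃ w : (Fin d → ℝ) → ℝ, Continuous w ∧
      ∀ x, Tendsto (fun n => G.indicator (V (gridPoint n (gridFloor n x))) ω) atTop
        (𝓝 (w x)) := by
    intro ω
    by_cases hω : ω ∈ G
    · have hq : (2 / 3 : ℝ) ^ (p : ℝ)⁻¹ < 1 :=
        Real.rpow_lt_one (by norm_num) (by norm_num) (by positivity)
      obtain ⟨w, hw1, hw2⟩ := exists_continuous_of_dyadic_increments (fun x => V x ω)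
        (Real.rpow_pos_of_pos (by norm_num) _) hq
        fun m => abs_increment_le_of_tsum_gridVariation hp (hω m)
      refine ⟨w, hw1, fun x => ?_⟩
      simpa [hω] using hw2 x
    · exact ⟨fun _ => 0, continuous_const, fun x => by simp [hω]⟩
  choose W hWc hWt using hex
  refine ⟨fun x ω => W ω x, fun x => ?_, hWc, fun x hx => ?_⟩
  · exact measurable_of_tendsto_metrizable (fun n => (hV _).indicator hGm)
      (tendsto_pi_nhds.2 fun ω => hWt ω x)
  · filter_upwards [hGae, ae_tendsto_gridFloor hV hA hp hC hinc hx] with ω hω hlim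
    refine tendsto_nhds_unique (hWt ω x) ?_
    simpa [hω] using hlim

/-- The Kolmogorov continuity criterion on `ℝ^d`. The moment bound is only required on a set `A`
containing the dyadic points; the continuous field agrees a.s. with `V` at every point of `A`. -/
theorem exists_continuous_modification {V : (Fin d → ℝ) → Ω → ℝ}
    {A : Set (Fin d → ℝ)} (hV : ∀ x ∈ A, AEMeasurable (V x) μ)
    (hA : ∀ n k, gridPoint n k ∈ A) {p : ℕ} (hp : p ≠ 0) {C : ℝ≥0∞}
    (hC : C ≠ ∞)
    (hinc : ∀ x ∈ A, ∀ y ∈ A, dist x y ≤ 1 →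
      ∫⁻ ω, ‖V x ω - V y ω‖ₑ ^ p ∂μ ≤ C * ENNReal.ofReal (dist x y) ^ (d + 1)) :
    ∃ W : (Fin d → ℝ) → Ω → ℝ, (∀ x, Measurable (W x)) ∧ (∀ ω, Continuous fun x => W x ω) ∧
      ∀ x ∈ A, W x =ᵐ[μ] V x := by
  classical
  -- Measurable representatives on `A`; values off `A` never enter the estimates.
  set V' : (Fin d → ℝ) → Ω → ℝ := fun x => if h : x ∈ A then (hV x h).mk (V x) else 0
  have hV' : ∀ x, Measurable (V' x) := fun x => by
    by_cases h : x ∈ A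
    · simpa [V', h] using (hV x h).measurable_mk
    · simpa [V', h] using (measurable_zero : Measurable (0 : Ω → ℝ))
  have heq : ∀ x ∈ A, V' x =ᵐ[μ] V x := fun x hx => by
    simpa [V', hx] using (hV x hx).ae_eq_mk.symm
  obtain ⟨W, h1, h2, h3⟩ := exists_continuous_modification_of_measurable (μ := μ) hV' hA hp hC
    fun x hx y hy hxy => by
      refine le_trans (le_of_eq (lintegral_congr_ae ?_)) (hinc x hx y hy hxy)
      filter_upwards [heq x hx, heq y hy] with ω e1 e2
      rw [e1, e2]
  exact ⟨W, h1, h2, fun x hx => (h3 x hx).trans (heq x hx)⟩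

/-- The absolute moments of a centered Gaussian variable are bounded by powers of its standard
deviation. -/
lemma exists_gaussian_moment_bound {p : ℕ} (hp : p ≠ 0) : ∃ M : ℝ≥0∞, M ≠ ∞ ∧
    ∀ {Ω : Type*} [MeasurableSpace Ω] {μ : Measure Ω} {Z : Ω → ℝ}, HasGaussianLaw Z μ →
      ∫ ω, Z ω ∂μ = 0 →
      ∫⁻ ω, ‖Z ω‖ₑ ^ p ∂μ ≤ M * ENNReal.ofReal √(∫ ω, Z ω ^ 2 ∂μ) ^ p := by
  refine ⟨∫⁻ x, ‖x‖ₑ ^ p ∂gaussianReal 0 1, ?_, fun {Ω} _ {μ Z} hZ hZ0 => le_of_eq ?_⟩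
  · have h := (memLp_id_gaussianReal (μ := 0) (v := 1) p).2
    rw [eLpNorm_lt_top_iff_lintegral_rpow_enorm_lt_top (by exact_mod_cast hp) (by simp)] at h
    simpa using h.ne
  have hv : Var[Z; μ] = ∫ ω, Z ω ^ 2 ∂μ := variance_of_integral_eq_zero hZ.aemeasurable hZ0
  have hmeas : Measurable fun x : ℝ => ‖x‖ₑ ^ p := measurable_enorm.pow_const p
  -- `Z` is distributed as its standard deviation times a standard normal, so the moment scales
  -- exactly.
  have hmap : μ.map Z = (gaussianReal 0 1).map (fun x => √(∫ ω, Z ω ^ 2 ∂μ) * x) := by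
    rw [hZ.map_eq_gaussianReal, hZ0, gaussianReal_map_const_mul, hv, mul_zero]
    congr 1
    apply NNReal.eq
    have : 0 ≤ ∫ ω, Z ω ^ 2 ∂μ := integral_nonneg fun ω => sq_nonneg _
    simp [Real.sq_sqrt, this]
  calc ∫⁻ ω, ‖Z ω‖ₑ ^ p ∂μ = ∫⁻ x, ‖x‖ₑ ^ p ∂(μ.map Z) :=
        (lintegral_map' hmeas.aemeasurable hZ.aemeasurable).symm
    _ = ∫⁻ x, ‖√(∫ ω, Z ω ^ 2 ∂μ) * x‖ₑ ^ p ∂gaussianReal 0 1 := by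
        rw [hmap, lintegral_map hmeas (measurable_const_mul _)]
    _ = _ := by
        simp_rw [enorm_mul, mul_pow]
        rw [lintegral_const_mul _ hmeas, mul_comm, Real.enorm_of_nonneg (Real.sqrt_nonneg _)]

/-- A field on `ℝ^d` with centered Gaussian increments whose variance is at most
`K |x - y| ^ (2 a)` has a continuous modification. -/
theorem exists_continuous_modification_of_gaussian {V : (Fin d → ℝ) → Ω → ℝ}
    {A : Set (Fin d → ℝ)} (hV : ∀ x ∈ A, AEMeasurable (V x) μ)
    (hA : ∀ n k, gridPoint n k ∈ A)
    (hG : ∀ x ∈ A, ∀ y ∈ A, HasGaussianLaw (fun ω => V x ω - V y ω) μ)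
    (h0 : ∀ x ∈ A, ∀ y ∈ A, ∫ ω, (V x ω - V y ω) ∂μ = 0)
    {K a : ℝ} (ha : 0 < a)
    (hinc : ∀ x ∈ A, ∀ y ∈ A, dist x y ≤ 1 →
      ∫ ω, (V x ω - V y ω) ^ 2 ∂μ ≤ (K * dist x y ^ a) ^ 2) :
    ∃ W : (Fin d → ℝ) → Ω → ℝ, (∀ x, Measurable (W x)) ∧ (∀ ω, Continuous fun x => W x ω) ∧
      ∀ x ∈ A, W x =ᵐ[μ] V x := by
  -- With `p a > d + 1`, `dist^{ap} ≤ dist^{d+1}` for distances at most `1`, however small `a` is.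
  obtain ⟨p, hp⟩ := exists_nat_gt ((d + 1) / a)
  rw [div_lt_iff₀ ha] at hp
  have hp0 : p ≠ 0 := by
    rintro rfl
    have : (0 : ℝ) ≤ d := d.cast_nonneg
    simp only [Nat.cast_zero, zero_mul] at hp
    linarith
  obtain ⟨M, hM, hmom⟩ := exists_gaussian_moment_bound hp0
  refine exists_continuous_modification hV hA hp0 (C := M * ENNReal.ofReal |K| ^ p)
    (ENNReal.mul_ne_top hM (ENNReal.pow_ne_top ENNReal.ofReal_ne_top)) fun x hx y hy hxy => ?_
  refine (hmom (hG x hx y hy) (h0 x hx y hy)).trans ?_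
  rw [mul_assoc]
  gcongr
  have hd : 0 ≤ dist x y := dist_nonneg
  have h1 : √(∫ ω, (V x ω - V y ω) ^ 2 ∂μ) ≤ |K| * dist x y ^ a := by
    refine (Real.sqrt_le_sqrt (hinc x hx y hy hxy)).trans ?_
    rw [Real.sqrt_sq_eq_abs, abs_mul, abs_of_nonneg (Real.rpow_nonneg hd a)]
  calc ENNReal.ofReal √(∫ ω, (V x ω - V y ω) ^ 2 ∂μ) ^ p
      ≤ ENNReal.ofReal (|K| * dist x y ^ a) ^ p := by gcongr
    _ = ENNReal.ofReal |K| ^ p * ENNReal.ofReal ((dist x y ^ a) ^ p) := by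
        rw [ENNReal.ofReal_mul (abs_nonneg K), mul_pow,
          ENNReal.ofReal_pow (Real.rpow_nonneg hd a)]
    _ ≤ ENNReal.ofReal |K| ^ p * ENNReal.ofReal (dist x y ^ (d + 1)) := by
        gcongr
        rw [← Real.rpow_mul_natCast hd, ← Real.rpow_natCast]
        rcases hd.eq_or_lt with h | h
        · rw [← h, Real.zero_rpow, Real.zero_rpow] <;> positivity
        · refine Real.rpow_le_rpow_of_exponent_ge h hxy ?_
          push_cast
          linarith
    _ = _ := by rw [ENNReal.ofReal_pow hd]

end

/-! ### Exponential kernels and the spectral isometry. -/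

noncomputable section

open scoped ENNReal NNReal

open Complex in
lemma norm_exp_I_mul_sub_exp_I_mul_le (x y : ℝ) : ‖exp (I * x) - exp (I * y)‖ ≤ |x - y| := by
  have h : exp (I * x) - exp (I * y) = exp (I * y) * (exp (I * ((x - y : ℝ) : ℂ)) - 1) := by
    rw [mul_sub, ← Complex.exp_add, mul_one]
    congr 2
    push_cast
    ring
  rw [h, norm_mul, mul_comm I (y : ℂ), Complex.norm_exp_ofReal_mul_I, one_mul]
  exact Real.norm_exp_I_mul_ofReal_sub_one_le

open Complex in
lemma norm_exp_I_mul_sub_exp_I_mul_le_two (x y : ℝ) : ‖exp (I * x) - exp (I * y)‖ ≤ 2 := by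
  refine (norm_sub_le _ _).trans (le_of_eq ?_)
  rw [mul_comm I (y : ℂ), mul_comm I (x : ℂ), Complex.norm_exp_ofReal_mul_I,
    Complex.norm_exp_ofReal_mul_I]
  norm_num

-- Interpolates between the Lipschitz bound, used when `|x - y| ≤ 1`, and the trivial bound `2`.
open Complex in
lemma norm_exp_I_mul_sub_exp_I_mul_le_rpow (x y : ℝ) {a : ℝ} (ha : 0 < a) (ha1 : a ≤ 1) :
    ‖exp (I * x) - exp (I * y)‖ ≤ 2 * |x - y| ^ a := by
  rcases le_total |x - y| 1 with h | h
  · refine (norm_exp_I_mul_sub_exp_I_mul_le x y).trans ?_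
    have h1 : |x - y| ≤ |x - y| ^ a := Real.self_le_rpow_of_le_one (abs_nonneg _) h ha1
    have h2 : 0 ≤ |x - y| ^ a := by positivity
    linarith
  · refine (norm_exp_I_mul_sub_exp_I_mul_le_two x y).trans ?_
    have := Real.one_le_rpow h ha.le
    linarith

-- Writing the quotient as an average of derivatives removes the singular factor `1 / h`.
open Complex in
lemma exp_difference_quotient_eq_integral (x u : ℝ) {h : ℝ} (hh : h ≠ 0) :
    (exp (I * (x + h * u : ℝ)) - exp (I * x)) / h
      = ∫ θ in (0 : ℝ)..1, I * u * exp (I * (x + θ * (h * u) : ℝ)) := by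
  have hderiv : ∀ θ ∈ Set.uIcc (0 : ℝ) 1, HasDerivAt
      (fun θ : ℝ => exp (I * (x + θ * (h * u) : ℝ)) / h)
      (I * u * exp (I * (x + θ * (h * u) : ℝ))) θ := by
    intro θ _
    have h1 : HasDerivAt (fun θ : ℝ => x + θ * (h * u)) (h * u) θ := by
      simpa using ((hasDerivAt_id θ).mul_const (h * u)).const_add x
    have h2 := ((h1.ofReal_comp.const_mul I).cexp).div_const (h : ℂ)
    refine h2.congr_deriv ?_
    have : (h : ℂ) ≠ 0 := by exact_mod_cast hh
    push_cast
    field_simp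
  rw [intervalIntegral.integral_eq_sub_of_hasDerivAt hderiv
    (Continuous.intervalIntegrable (by fun_prop) _ _)]
  simp [sub_div]

-- The kernel estimate behind differentiability: one factor `|u|` pays for the derivative, and a
-- Hölder modulus in base point and step remains, with a constant independent of how small `h` and
-- `k` are.
open Complex in
lemma norm_exp_difference_quotient_sub_le (x y u : ℝ) {h k : ℝ} (hh : h ≠ 0) (hk : k ≠ 0) {a : ℝ}
    (ha : 0 < a) (ha1 : a ≤ 1) :
    ‖(exp (I * (x + h * u : ℝ)) - exp (I * x)) / h
      - (exp (I * (y + k * u : ℝ)) - exp (I * y)) / k‖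
      ≤ 2 * |u| * (|x - y| + |h - k| * |u|) ^ a := by
  rw [exp_difference_quotient_eq_integral x u hh, exp_difference_quotient_eq_integral y u hk,
    ← intervalIntegral.integral_sub (Continuous.intervalIntegrable (by fun_prop) _ _)
      (Continuous.intervalIntegrable (by fun_prop) _ _)]
  have := intervalIntegral.norm_integral_le_of_norm_le_const (a := (0 : ℝ)) (b := 1)
    (C := 2 * |u| * (|x - y| + |h - k| * |u|) ^ a)
    (f := fun θ : ℝ => I * u * exp (I * (x + θ * (h * u) : ℝ))
      - I * u * exp (I * (y + θ * (k * u) : ℝ))) ?_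
  · simpa using this
  intro θ hθ
  rw [Set.uIoc_of_le zero_le_one] at hθ
  rw [← mul_sub, norm_mul, norm_mul, Complex.norm_I, one_mul, Complex.norm_real, Real.norm_eq_abs]
  have h1 := norm_exp_I_mul_sub_exp_I_mul_le_rpow (x + θ * (h * u)) (y + θ * (k * u)) ha ha1
  have h2 : |(x + θ * (h * u)) - (y + θ * (k * u))| ≤ |x - y| + |h - k| * |u| := by
    have : (x + θ * (h * u)) - (y + θ * (k * u)) = (x - y) + θ * ((h - k) * u) := by ring
    rw [this]
    refine (abs_add_le _ _).trans (add_le_add_right ?_ _)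
    rw [abs_mul, abs_mul, abs_of_pos hθ.1]
    exact mul_le_of_le_one_left (by positivity) hθ.2
  have h3 := Real.rpow_le_rpow (abs_nonneg _) h2 ha.le
  calc |u| * _ ≤ |u| * (2 * (|x - y| + |h - k| * |u|) ^ a) := by gcongr; linarith
    _ = _ := by ring

/-- The kernel `x ↦ e^{i⟨t, x⟩} - 1` of the spectral representation. -/
def spectralKernel {N : ℕ} (t x : EuclideanSpace ℝ (Fin N)) : ℂ :=
  Complex.exp (Complex.I * (inner ℝ t x : ℝ)) - 1

lemma measurable_spectralKernel {N : ℕ} (t : EuclideanSpace ℝ (Fin N)) :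
    Measurable (spectralKernel t) := by
  unfold spectralKernel
  fun_prop

lemma conj_spectralKernel {N : ℕ} (t x : EuclideanSpace ℝ (Fin N)) :
    (starRingEnd ℂ) (spectralKernel t x)
      = Complex.exp (-(Complex.I * (inner ℝ t x : ℝ))) - 1 := by
  rw [spectralKernel, map_sub, ← Complex.exp_conj, map_mul, Complex.conj_I, Complex.conj_ofReal,
    map_one, neg_mul]

/-- Combines the bounds `2` and `‖t‖ ‖x‖`; the right-hand weight is the one a spectral measure
integrates. -/
lemma norm_spectralKernel_sq_le {N : ℕ} (t x : EuclideanSpace ℝ (Fin N)) :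
    ‖spectralKernel t x‖ ^ 2 ≤ (‖t‖ ^ 2 + 4) * (‖x‖ ^ 2 / (1 + ‖x‖ ^ 2)) := by
  have h1 : ‖spectralKernel t x‖ ≤ 2 := by
    simpa [spectralKernel] using norm_exp_I_mul_sub_exp_I_mul_le_two (inner ℝ t x) 0
  have h2 : ‖spectralKernel t x‖ ≤ ‖t‖ * ‖x‖ := by
    have := norm_exp_I_mul_sub_exp_I_mul_le (inner ℝ t x) 0
    rw [sub_zero, Complex.ofReal_zero, mul_zero, Complex.exp_zero] at this
    exact this.trans (abs_real_inner_le_norm t x)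
  have h0 := norm_nonneg (spectralKernel t x)
  have h3 : ‖spectralKernel t x‖ ^ 2 ≤ 4 := by nlinarith
  have h4 : ‖spectralKernel t x‖ ^ 2 ≤ ‖t‖ ^ 2 * ‖x‖ ^ 2 := by
    rw [← mul_pow]; gcongr
  rw [← mul_div_assoc, le_div_iff₀ (by positivity)]
  nlinarith [mul_le_mul_of_nonneg_right h3 (sq_nonneg ‖x‖)]

section Spectral

variable {N : ℕ} {Ω : Type*} [MeasurableSpace Ω] {μ : Measure Ω}
  {X : EuclideanSpace ℝ (Fin N) → Ω → ℝ} {F : Measure (EuclideanSpace ℝ (Fin N))}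

lemma IsSpectralMeasure.integrable (hF : IsSpectralMeasure X μ F) :
    Integrable (fun x => ‖x‖ ^ 2 / (1 + ‖x‖ ^ 2)) F := by
  refine ⟨(by fun_prop : Measurable _).aestronglyMeasurable, ?_⟩
  rw [hasFiniteIntegral_iff_ofReal (Eventually.of_forall fun x => by positivity)]
  exact hF.finite

lemma IsSpectralMeasure.memLp_spectralKernel (hF : IsSpectralMeasure X μ F)
    (t : EuclideanSpace ℝ (Fin N)) : MemLp (spectralKernel t) 2 F := by
  rw [memLp_two_iff_integrable_sq_norm (measurable_spectralKernel t).aestronglyMeasurable]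
  refine (hF.integrable.const_mul (‖t‖ ^ 2 + 4)).mono'
    ((measurable_spectralKernel t).norm.pow_const 2).aestronglyMeasurable ?_
  refine Eventually.of_forall fun x => ?_
  rw [Real.norm_of_nonneg (by positivity)]
  exact norm_spectralKernel_sq_le t x

/-- The spectral isometry. -/
lemma IsSpectralMeasure.integral_sum_sq (hF : IsSpectralMeasure X μ F)
    (hX : IsGaussianProcess X μ) {n : ℕ} (c : Fin n → ℝ) (t : Fin n → EuclideanSpace ℝ (Fin N)) :
    ∫ ω, (∑ i, c i * X (t i) ω) ^ 2 ∂μ = ∫ x, ‖∑ i, (c i : ℂ) * spectralKernel (t i) x‖ ^ 2 ∂F := by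
  have hint : ∀ i k, Integrable (fun ω => c i * X (t i) ω * (c k * X (t k) ω)) μ := fun i k =>
    ((hX.hasGaussianLaw_eval (t i)).memLp_two.const_mul (c i)).integrable_mul
      ((hX.hasGaussianLaw_eval (t k)).memLp_two.const_mul (c k))
  have hconj : ∀ s, MemLp (fun x => (starRingEnd ℂ) (spectralKernel s x)) 2 F := fun s =>
    (hF.memLp_spectralKernel s).star
  have hint' : ∀ i k, Integrable (fun x => (c i : ℂ) * spectralKernel (t i) x *
      ((c k : ℂ) * (starRingEnd ℂ) (spectralKernel (t k) x))) F := fun i k =>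
    ((hF.memLp_spectralKernel (t i)).const_mul (c i : ℂ)).integrable_mul
      ((hconj (t k)).const_mul (c k : ℂ))
  have hcast : ((∫ x, ‖∑ i, (c i : ℂ) * spectralKernel (t i) x‖ ^ 2 ∂F : ℝ) : ℂ)
      = ∫ x, ((‖∑ i, (c i : ℂ) * spectralKernel (t i) x‖ ^ 2 : ℝ) : ℂ) ∂F :=
    integral_complex_ofReal.symm
  rw [← Complex.ofReal_inj, hcast]
  -- Expand `|z|² = z z̄` as a double sum, to be matched termwise with the covariances.
  have hR : ∀ x, ((‖∑ i, (c i : ℂ) * spectralKernel (t i) x‖ ^ 2 : ℝ) : ℂ)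
      = ∑ i, ∑ k, (c i : ℂ) * spectralKernel (t i) x *
        ((c k : ℂ) * (starRingEnd ℂ) (spectralKernel (t k) x)) := by
    intro x
    rw [Complex.ofReal_pow, ← Complex.mul_conj', map_sum, Finset.sum_mul_sum]
    simp
  simp_rw [hR, pow_two, Finset.sum_mul_sum]
  rw [integral_finsetSum _ fun i _ => integrable_finsetSum _ fun k _ => hint i k,
    integral_finsetSum _ fun i _ => integrable_finsetSum _ fun k _ => hint' i k,
    Complex.ofReal_sum]
  refine Finset.sum_congr rfl fun i _ => ?_
  rw [integral_finsetSum _ fun k _ => hint i k, integral_finsetSum _ fun k _ => hint' i k,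
    Complex.ofReal_sum]
  refine Finset.sum_congr rfl fun k _ => ?_
  have e1 : ∀ ω, c i * X (t i) ω * (c k * X (t k) ω) = c i * c k * (X (t i) ω * X (t k) ω) :=
    fun ω => mul_mul_mul_comm _ _ _ _
  have e2 : ∀ x, (c i : ℂ) * spectralKernel (t i) x *
      ((c k : ℂ) * (starRingEnd ℂ) (spectralKernel (t k) x)) =
      (c i : ℂ) * c k * (spectralKernel (t i) x * (starRingEnd ℂ) (spectralKernel (t k) x)) :=
    fun x => mul_mul_mul_comm _ _ _ _
  simp_rw [e1, e2]
  rw [integral_const_mul, integral_const_mul, Complex.ofReal_mul, Complex.ofReal_mul,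
    hF.covariance]
  simp_rw [conj_spectralKernel]
  rfl

lemma hasGaussianLaw_linear_combination (hX : IsGaussianProcess X μ) {n : ℕ} (c : Fin n → ℝ)
    (t : Fin n → EuclideanSpace ℝ (Fin N)) :
    HasGaussianLaw (fun ω => ∑ i, c i * X (t i) ω) μ :=
  ((hX.comp_right t).smul c).hasGaussianLaw_fun_sum (I := Finset.univ)

lemma integral_linear_combination_eq_zero (hX : IsGaussianProcess X μ)
    (h0 : ∀ t, ∫ ω, X t ω ∂μ = 0) {n : ℕ} (c : Fin n → ℝ)
    (t : Fin n → EuclideanSpace ℝ (Fin N)) : ∫ ω, ∑ i, c i * X (t i) ω ∂μ = 0 := by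
  rw [integral_finsetSum _ fun i _ => (hX.hasGaussianLaw_eval (t i)).integrable.const_mul (c i)]
  simp [integral_const_mul, h0]

/-- If the kernel of a linear combination of values of `X` is dominated by `r * w`, its variance is
at most `r ^ 2 * ∫ w ^ 2`. -/
lemma IsSpectralMeasure.integral_sum_sq_le (hF : IsSpectralMeasure X μ F)
    (hX : IsGaussianProcess X μ) {n : ℕ} (c : Fin n → ℝ) (t : Fin n → EuclideanSpace ℝ (Fin N))
    {w : EuclideanSpace ℝ (Fin N) → ℝ} (hw : Integrable (fun x => w x ^ 2) F) {r : ℝ}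
    (h : ∀ x, ‖∑ i, (c i : ℂ) * spectralKernel (t i) x‖ ≤ r * w x) :
    ∫ ω, (∑ i, c i * X (t i) ω) ^ 2 ∂μ ≤ (√(∫ x, w x ^ 2 ∂F) * r) ^ 2 := by
  rw [hF.integral_sum_sq hX, mul_pow, Real.sq_sqrt (integral_nonneg fun x => sq_nonneg _),
    mul_comm, ← integral_const_mul]
  refine integral_mono_of_nonneg (Eventually.of_forall fun x => by positivity)
    (hw.const_mul _) (Eventually.of_forall fun x => ?_)
  simp only [← mul_pow]
  exact pow_le_pow_left₀ (norm_nonneg _) (h x) 2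

end Spectral

end

/-! ### The anisotropic gauge and integrability under Condition (C). -/

noncomputable section

open scoped ENNReal NNReal

lemma integrable_one_add_abs_rpow_rpow_neg {b s : ℝ} (hb : 0 < b) (hs : 0 < s) (h : 1 < b * s) :
    Integrable fun x : ℝ => (1 + |x| ^ b) ^ (-s) := by
  have h1 : Integrable fun x : ℝ => (1 + ‖x‖) ^ (-(b * s)) :=
    integrable_one_add_norm (by simpa using h)
  refine (h1.const_mul ((2 ^ b) ^ s)).mono' (by fun_prop : Measurable _).aestronglyMeasurable
    (Eventually.of_forall fun x => ?_)
  have hx : 0 ≤ |x| := abs_nonneg x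
  have h2 : (1 + |x|) ^ b ≤ 2 ^ b * (1 + |x| ^ b) := by
    rcases le_total |x| 1 with hx1 | hx1
    · calc (1 + |x|) ^ b ≤ 2 ^ b := Real.rpow_le_rpow (by positivity) (by linarith) hb.le
        _ ≤ 2 ^ b * (1 + |x| ^ b) := le_mul_of_one_le_right (by positivity)
          (by linarith [Real.rpow_nonneg hx b])
    · calc (1 + |x|) ^ b ≤ (2 * |x|) ^ b :=
          Real.rpow_le_rpow (by positivity) (by linarith) hb.le
        _ = 2 ^ b * |x| ^ b := Real.mul_rpow (by norm_num) hx
        _ ≤ 2 ^ b * (1 + |x| ^ b) := by gcongr; linarith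
  have h3 := Real.rpow_le_rpow (by positivity) h2 hs.le
  rw [Real.mul_rpow (by positivity) (by positivity), ← Real.rpow_mul (by positivity)] at h3
  rw [Real.norm_of_nonneg (by positivity), Real.norm_eq_abs, Real.rpow_neg (by positivity),
    Real.rpow_neg (by positivity), ← div_eq_mul_inv, le_div_iff₀ (by positivity),
    inv_mul_le_iff₀ (by positivity)]
  linarith

/-- The anisotropic gauge `∑ j, |x_j| ^ β_j`. -/
def gauge {N : ℕ} (β : Fin N → ℝ) (x : EuclideanSpace ℝ (Fin N)) : ℝ := ∑ j, |x j| ^ β j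

section Gauge

variable {N : ℕ} {β : Fin N → ℝ}

lemma gauge_nonneg (x : EuclideanSpace ℝ (Fin N)) : 0 ≤ gauge β x :=
  Finset.sum_nonneg fun _ _ => Real.rpow_nonneg (abs_nonneg _) _

lemma measurable_gauge : Measurable (gauge β) := by
  unfold gauge
  fun_prop

lemma abs_rpow_le_gauge (x : EuclideanSpace ℝ (Fin N)) (j : Fin N) : |x j| ^ β j ≤ gauge β x :=
  Finset.single_le_sum (f := fun j => |x j| ^ β j)
    (fun _ _ => Real.rpow_nonneg (abs_nonneg _) _) (Finset.mem_univ j)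

lemma abs_le_gauge_rpow (hβ : ∀ j, 0 < β j) (x : EuclideanSpace ℝ (Fin N)) (j : Fin N) :
    |x j| ≤ gauge β x ^ (1 / β j) := by
  have h := Real.rpow_le_rpow (Real.rpow_nonneg (abs_nonneg _) _) (abs_rpow_le_gauge (β := β) x j)
    (one_div_nonneg.2 (hβ j).le)
  rwa [← Real.rpow_mul (abs_nonneg _), mul_one_div_cancel (hβ j).ne', Real.rpow_one] at h

lemma norm_le_sum_abs (x : EuclideanSpace ℝ (Fin N)) : ‖x‖ ≤ ∑ j, |x j| := by
  rw [EuclideanSpace.norm_eq]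
  refine Real.sqrt_le_iff.2 ⟨Finset.sum_nonneg fun _ _ => abs_nonneg _, ?_⟩
  simp only [Real.norm_eq_abs]
  exact Finset.sum_sq_le_sq_sum_of_nonneg fun _ _ => abs_nonneg _

/-- A gauge below `c` forces `|x_j| ≤ c^{1/β_j}` for all `j`, hence `‖x‖ < R` once `c` is small. -/
lemma exists_pos_le_gauge (hβ : ∀ j, 0 < β j) {R : ℝ} (hR : 0 < R) :
    ∃ c, 0 < c ∧ ∀ x : EuclideanSpace ℝ (Fin N), R ≤ ‖x‖ → c ≤ gauge β x := by
  have hT : Tendsto (fun c : ℝ => ∑ j, c ^ (1 / β j)) (𝓝[>] 0) (𝓝 (∑ _j : Fin N, 0)) := by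
    refine tendsto_finsetSum _ fun j _ => ?_
    have h := (Real.continuousAt_rpow_const 0 (1 / β j) (Or.inr (one_div_pos.2 (hβ j)).le)).tendsto
    rw [Real.zero_rpow (one_div_pos.2 (hβ j)).ne'] at h
    exact h.mono_left nhdsWithin_le_nhds
  rw [Finset.sum_const_zero] at hT
  obtain ⟨c, hc, hc0⟩ := ((hT.eventually (gt_mem_nhds hR)).and self_mem_nhdsWithin).exists
  refine ⟨c, hc0, fun x hx => ?_⟩
  by_contra! hlt
  have : ‖x‖ ≤ ∑ j, c ^ (1 / β j) := (norm_le_sum_abs x).trans <| Finset.sum_le_sum fun j _ =>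
    (abs_le_gauge_rpow hβ x j).trans
      (Real.rpow_le_rpow (gauge_nonneg x) hlt.le (one_div_nonneg.2 (hβ j).le))
  linarith

/-- Away from the origin the gauge is bounded below, so each exponent `1 / β_j` may be raised to
their sum. This crude exponent is harmless: it is later multiplied by an arbitrarily small `a`. -/
lemma exists_norm_le_gauge_rpow (hβ : ∀ j, 0 < β j) {R : ℝ} (hR : 0 < R) :
    ∃ C, 0 ≤ C ∧ ∀ x : EuclideanSpace ℝ (Fin N), R ≤ ‖x‖ →
      ‖x‖ ≤ C * gauge β x ^ (∑ j, 1 / β j) := by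
  obtain ⟨c, hc, h⟩ := exists_pos_le_gauge hβ hR
  set b := ∑ j, 1 / β j with hb
  refine ⟨∑ j, c ^ (-(b - 1 / β j)), Finset.sum_nonneg fun j _ => by positivity, fun x hx => ?_⟩
  have hS := hc.trans_le (h x hx)
  rw [Finset.sum_mul]
  refine (norm_le_sum_abs x).trans (Finset.sum_le_sum fun j _ => ?_)
  have hbj : -(b - 1 / β j) ≤ 0 := by
    have : 1 / β j ≤ b := Finset.single_le_sum (f := fun j => 1 / β j)
      (fun i _ => one_div_nonneg.2 (hβ i).le) (Finset.mem_univ j)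
    linarith
  calc |x j| ≤ gauge β x ^ (1 / β j) := abs_le_gauge_rpow hβ x j
    _ = gauge β x ^ (-(b - 1 / β j)) * gauge β x ^ b := by
        rw [← Real.rpow_add hS]; congr 1; ring
    _ ≤ c ^ (-(b - 1 / β j)) * gauge β x ^ b := by
        refine mul_le_mul_of_nonneg_right ?_ (by positivity)
        exact Real.rpow_le_rpow_of_nonpos hc (h x hx) hbj

lemma integrable_one_add_gauge_rpow_neg (hβ : ∀ j, 0 < β j) {s : ℝ} (hs : ∑ j, 1 / β j < s) :
    Integrable fun x : EuclideanSpace ℝ (Fin N) => (1 + gauge β x) ^ (-s) := by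
  set b := ∑ j, 1 / β j with hb
  have hb0 : 0 ≤ b := Finset.sum_nonneg fun j _ => one_div_nonneg.2 (hβ j).le
  have hs0 : 0 < s := hb0.trans_lt hs
  have hbpos : ∀ j : Fin N, 0 < b := fun j =>
    Finset.sum_pos (fun i _ => one_div_pos.2 (hβ i)) ⟨j, Finset.mem_univ j⟩
  -- Splits `s` proportionally to `1 / β_j`, so that `β_j q_j = s / b > 1`: the gauge weight is
  -- dominated by a product of integrable one-variable functions.
  set q : Fin N → ℝ := fun j => s * (1 / β j / b) with hq
  have hqpos : ∀ j, 0 < q j := fun j =>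
    mul_pos hs0 (div_pos (one_div_pos.2 (hβ j)) (hbpos j))
  have hprod : Integrable fun y : Fin N → ℝ => ∏ j, (1 + |y j| ^ β j) ^ (-(q j)) := by
    refine Integrable.fintype_prod (f := fun j y => (1 + |y| ^ β j) ^ (-(q j))) fun j => ?_
    refine integrable_one_add_abs_rpow_rpow_neg (hβ j) (hqpos j) ?_
    have : β j * q j = s / b := by
      have := (hβ j).ne'
      have := (hbpos j).ne'
      simp only [hq]
      field_simp
    rw [this, one_lt_div (hbpos j)]
    exact hs
  have hprod' := (PiLp.volume_preserving_ofLp (Fin N)).integrable_comp_of_integrable hprod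
  refine hprod'.mono' ((measurable_gauge.const_add 1).pow_const _).aestronglyMeasurable
    (Eventually.of_forall fun x => ?_)
  have hS : 1 ≤ 1 + gauge β x := by linarith [gauge_nonneg (β := β) x]
  rw [Real.norm_of_nonneg (by positivity)]
  have hle : ∏ j, (1 + |x j| ^ β j) ^ (q j) ≤ (1 + gauge β x) ^ s := by
    calc ∏ j, (1 + |x j| ^ β j) ^ (q j) ≤ ∏ j, (1 + gauge β x) ^ (q j) := by
          refine Finset.prod_le_prod (fun j _ => by positivity) fun j _ => ?_
          exact Real.rpow_le_rpow (by positivity)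
            (by linarith [abs_rpow_le_gauge (β := β) x j]) (hqpos j).le
      _ = (1 + gauge β x) ^ (∑ j, q j) := (Real.rpow_sum_of_pos (by linarith) _ _).symm
      _ ≤ (1 + gauge β x) ^ s := by
          refine Real.rpow_le_rpow_of_exponent_le hS ?_
          rw [← Finset.mul_sum, ← Finset.sum_div, ← hb]
          exact mul_le_of_le_one_right hs0.le (div_self_le_one b)
  have hpos : 0 < ∏ j, (1 + |x j| ^ β j) ^ (q j) := Finset.prod_pos fun j _ => by positivity
  calc (1 + gauge β x) ^ (-s) = ((1 + gauge β x) ^ s)⁻¹ := Real.rpow_neg (by linarith) _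
    _ ≤ (∏ j, (1 + |x j| ^ β j) ^ (q j))⁻¹ := inv_anti₀ hpos hle
    _ = ∏ j, (1 + |x j| ^ β j) ^ (-(q j)) := by
        rw [← Finset.prod_inv_distrib]
        exact Finset.prod_congr rfl fun j _ => (Real.rpow_neg (by positivity) _).symm

/-- Under Condition (C), a weight of order `|x|²` on balls that grows at most like a power of the
gauge with exponent below `γ - ∑ 1 / β_j` is integrable for the spectral measure. -/
lemma ConditionC.integrable_withDensity {Ω : Type*} [MeasurableSpace Ω] {μ : Measure Ω}
    {X : EuclideanSpace ℝ (Fin N) → Ω → ℝ} {f : EuclideanSpace ℝ (Fin N) → ℝ} {γ : ℝ}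
    (hC : ConditionC f γ β) (hf : HasSpectralDensity X μ f)
    {g : EuclideanSpace ℝ (Fin N) → ℝ} (hg : Measurable g) (hg0 : ∀ x, 0 ≤ g x) {κ : ℝ}
    (hκ : κ < γ - ∑ j, 1 / β j)
    (hbound : ∀ R : ℝ, 0 < R → ∃ C, 0 ≤ C ∧ (∀ x, ‖x‖ ≤ R → g x ≤ C * ‖x‖ ^ 2) ∧
      ∀ x, R ≤ ‖x‖ → g x ≤ C * gauge β x ^ κ) :
    Integrable g (volume.withDensity fun x => ENNReal.ofReal (f x)) := by
  obtain ⟨c₁, c₂, R, -, hc₂, hR, hfb⟩ := hC.bounds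
  obtain ⟨C, hC0, hsmall, hlarge⟩ := hbound R hR
  obtain ⟨c, hc, hgc⟩ := exists_pos_le_gauge hC.beta_pos hR
  have hB : MeasurableSet {x : EuclideanSpace ℝ (Fin N) | R ≤ ‖x‖} :=
    measurableSet_le measurable_const measurable_norm
  -- Low frequencies use the integrability built into a spectral measure; high frequencies use the
  -- upper bound on `f`.
  rw [← integrableOn_univ, ← Set.compl_union_self {x : EuclideanSpace ℝ (Fin N) | R ≤ ‖x‖}]
  refine IntegrableOn.union ?_ ?_
  · refine ((hf.spectral.integrable.const_mul (C * (1 + R ^ 2))).integrableOn).mono'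
      hg.aestronglyMeasurable (ae_restrict_of_forall_mem hB.compl fun x hx => ?_)
    have hxR : ‖x‖ ≤ R := le_of_not_ge fun h => hx h
    rw [Real.norm_of_nonneg (hg0 x)]
    refine (hsmall x hxR).trans ?_
    rw [mul_assoc]
    gcongr
    rw [mul_div_assoc', le_div_iff₀ (by positivity), mul_comm]
    gcongr
  · have hfm : Measurable fun x => ENNReal.ofReal (f x) := hf.measurable.ennreal_ofReal
    rw [IntegrableOn, restrict_withDensity hB, integrable_withDensity_iff hfm
      (Eventually.of_forall fun _ => ENNReal.ofReal_lt_top)]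
    have hint := (integrable_one_add_gauge_rpow_neg hC.beta_pos
      (s := γ - κ) (by linarith)).const_mul (C * c₂ * (c⁻¹ + 1) ^ (γ - κ))
    refine hint.integrableOn.mono' (hg.mul hfm.ennreal_toReal).aestronglyMeasurable
      (ae_restrict_of_forall_mem hB fun x hx => ?_)
    have hx' : R ≤ ‖x‖ := hx
    have hS : 0 < gauge β x := hc.trans_le (hgc x hx')
    rw [ENNReal.toReal_ofReal (hf.nonneg x), Real.norm_of_nonneg (mul_nonneg (hg0 x) (hf.nonneg x))]
    have hγκ : 0 ≤ γ - κ := by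
      have : 0 ≤ ∑ j, 1 / β j := Finset.sum_nonneg fun j _ => one_div_nonneg.2 (hC.beta_pos j).le
      linarith
    have h1 : (1 + gauge β x) ^ (γ - κ) ≤ (c⁻¹ + 1) ^ (γ - κ) * gauge β x ^ (γ - κ) := by
      rw [← Real.mul_rpow (by positivity) hS.le]
      refine Real.rpow_le_rpow (by positivity) ?_ hγκ
      have : 1 ≤ c⁻¹ * gauge β x := by
        rw [← div_eq_inv_mul, one_le_div hc]; exact hgc x hx'
      linarith
    calc g x * f x ≤ (C * gauge β x ^ κ) * (c₂ / gauge β x ^ γ) :=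
          mul_le_mul (hlarge x hx') (hfb x hx').2 (hf.nonneg x) (by positivity)
      _ = C * c₂ * (gauge β x ^ (γ - κ))⁻¹ := by
          rw [Real.rpow_sub hS]
          have := Real.rpow_pos_of_pos hS κ
          have := Real.rpow_pos_of_pos hS γ
          field_simp
      _ ≤ C * c₂ * ((c⁻¹ + 1) ^ (γ - κ) * (1 + gauge β x) ^ (-(γ - κ))) := by
          gcongr
          rw [Real.rpow_neg (by positivity), ← div_eq_mul_inv, le_div_iff₀ (by positivity),
            inv_mul_le_iff₀ (by positivity)]
          linarith
      _ = _ := by ring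

end Gauge

end

/-! ### Deterministic calculus with continuous difference quotients. -/

noncomputable section

variable {N : ℕ}

/-- The finite-difference analogue of differentiability along a coordinate direction. -/
def HasContinuousQuotient (g : EuclideanSpace ℝ (Fin N) → ℝ) (j : Fin N)
    (D : EuclideanSpace ℝ (Fin N) × ℝ → ℝ) : Prop :=
  Continuous D ∧ ∀ t (h : ℝ), g (t + h • EuclideanSpace.single j (1 : ℝ)) - g t = h * D (t, h)

lemma HasContinuousQuotient.hasLineDerivAt {g : EuclideanSpace ℝ (Fin N) → ℝ} {j : Fin N}
    {D : EuclideanSpace ℝ (Fin N) × ℝ → ℝ} (hD : HasContinuousQuotient g j D)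
    (t : EuclideanSpace ℝ (Fin N)) :
    HasLineDerivAt ℝ g (D (t, 0)) t (EuclideanSpace.single j (1 : ℝ)) := by
  rw [hasLineDerivAt_iff_tendsto_slope_zero]
  have h1 : Tendsto (fun h : ℝ => D (t, h)) (𝓝[≠] 0) (𝓝 (D (t, 0))) :=
    ((hD.1.comp (by fun_prop : Continuous fun h : ℝ => (t, h))).tendsto 0).mono_left
      nhdsWithin_le_nhds
  refine h1.congr' ?_
  filter_upwards [self_mem_nhdsWithin] with h hh
  rw [hD.2, smul_eq_mul, inv_mul_cancel_left₀ hh]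

/-- Continuity of `c` suffices because `L` vanishes at `0`: the error is `L v * (c v - c 0) =
o(‖v‖)`. -/
lemma hasFDerivAt_mul_of_continuousAt {E : Type*} [NormedAddCommGroup E] [NormedSpace ℝ E]
    (L : E →L[ℝ] ℝ) {c : E → ℝ} (hc : ContinuousAt c 0) :
    HasFDerivAt (fun v => L v * c v) (c 0 • L) 0 := by
  rw [hasFDerivAt_iff_isLittleO_nhds_zero]
  have h1 : (fun v => c v - c 0) =o[𝓝 0] (fun _ => (1 : ℝ)) := by
    rw [Asymptotics.isLittleO_one_iff]
    simpa using hc.tendsto.sub_const (c 0)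
  have hL : (fun v => L v) =O[𝓝 0] (fun v => ‖v‖) := (L.isBigO_id (𝓝 0)).norm_right
  refine (((hL.mul_isLittleO h1).congr_right fun v => mul_one _).of_norm_right).congr_left
    fun v => ?_
  simp only [zero_add, map_zero, zero_mul, sub_zero, smul_apply, smul_eq_mul]
  ring

lemma hasFDerivAt_of_hasContinuousQuotient {g : EuclideanSpace ℝ (Fin N) → ℝ}
    {D : Fin N → EuclideanSpace ℝ (Fin N) × ℝ → ℝ} (hD : ∀ j, HasContinuousQuotient g j (D j))
    (t : EuclideanSpace ℝ (Fin N)) :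
    HasFDerivAt g (∑ j, D j (t, 0) • (EuclideanSpace.proj j : EuclideanSpace ℝ (Fin N) →L[ℝ] ℝ))
      t := by
  classical
  -- Telescoping over coordinates: adding direction `j` contributes `v j` times `D j` at the point
  -- already reached, a factor continuous in `v`.
  have key : ∀ s : Finset (Fin N), HasFDerivAt
      (fun v : EuclideanSpace ℝ (Fin N) =>
        g (t + ∑ i ∈ s, v i • EuclideanSpace.single i (1 : ℝ)))
      (∑ j ∈ s, D j (t, 0) • (EuclideanSpace.proj j : EuclideanSpace ℝ (Fin N) →L[ℝ] ℝ)) 0 := by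
    intro s
    induction s using Finset.induction_on with
    | empty => simpa using hasFDerivAt_const (g t) (0 : EuclideanSpace ℝ (Fin N))
    | insert j s hj ih =>
      have hc : Continuous fun v : EuclideanSpace ℝ (Fin N) =>
          D j (t + ∑ i ∈ s, v i • EuclideanSpace.single i (1 : ℝ), v j) :=
        (hD j).1.comp (by fun_prop)
      have h1 := (hasFDerivAt_mul_of_continuousAt
        (EuclideanSpace.proj j : EuclideanSpace ℝ (Fin N) →L[ℝ] ℝ) hc.continuousAt).add ih
      rw [Finset.sum_insert hj]
      simp only [PiLp.zero_apply, zero_smul, Finset.sum_const_zero, add_zero] at h1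
      refine h1.congr_of_eventuallyEq (Eventually.of_forall fun v => ?_)
      have h2 := (hD j).2 (t + ∑ i ∈ s, v i • EuclideanSpace.single i (1 : ℝ)) (v j)
      simp only [Pi.add_apply]
      rw [show (EuclideanSpace.proj j : EuclideanSpace ℝ (Fin N) →L[ℝ] ℝ) v = v j from rfl, ← h2, Finset.sum_insert hj, add_comm (v j • _), ← add_assoc]
      ring
  have hsum : ∀ v : EuclideanSpace ℝ (Fin N), ∑ i, v i • EuclideanSpace.single i (1 : ℝ) = v := by
    intro v
    simpa using (EuclideanSpace.basisFun (Fin N) ℝ).sum_repr v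
  have h := key Finset.univ
  simp only [hsum] at h
  rw [hasFDerivAt_comp_add_left, add_zero] at h
  exact h

lemma contDiff_one_of_hasContinuousQuotient {g : EuclideanSpace ℝ (Fin N) → ℝ}
    {D : Fin N → EuclideanSpace ℝ (Fin N) × ℝ → ℝ} (hD : ∀ j, HasContinuousQuotient g j (D j)) :
    ContDiff ℝ 1 g := by
  rw [contDiff_one_iff_hasFDerivAt]
  refine ⟨_, ?_, hasFDerivAt_of_hasContinuousQuotient hD⟩
  refine continuous_finsetSum _ fun j _ => ?_
  have h : Continuous fun t => D j (t, 0) := (hD j).1.comp (by fun_prop)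
  exact h.smul continuous_const

lemma fderiv_eq_inner_grad {g : EuclideanSpace ℝ (Fin N) → ℝ} {t : EuclideanSpace ℝ (Fin N)}
    (hg : DifferentiableAt ℝ g t) (u : EuclideanSpace ℝ (Fin N)) :
    fderiv ℝ g t u = inner ℝ u (grad g t) := by
  have hsum : ∑ i, u i • EuclideanSpace.single i (1 : ℝ) = u := by
    simpa using (EuclideanSpace.basisFun (Fin N) ℝ).sum_repr u
  conv_lhs => rw [← hsum]
  rw [map_sum, PiLp.inner_apply]
  refine Finset.sum_congr rfl fun j _ => ?_
  rw [map_smul, ← hg.lineDeriv_eq_fderiv]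
  simp [grad, partialDeriv, mul_comm]

lemma tendsto_directional_remainder {g : EuclideanSpace ℝ (Fin N) → ℝ}
    {t : EuclideanSpace ℝ (Fin N)} (hg : DifferentiableAt ℝ g t) (u : EuclideanSpace ℝ (Fin N)) :
    Tendsto (fun h : ℝ => (g (t + h • u) - g t - h * inner ℝ u (grad g t)) / h)
      (𝓝[≠] 0) (𝓝 0) := by
  have h1 := (hg.hasFDerivAt.hasLineDerivAt u).tendsto_slope_zero
  rw [fderiv_eq_inner_grad hg] at h1
  have h2 := h1.sub_const (inner ℝ u (grad g t))
  rw [sub_self] at h2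
  refine h2.congr' ?_
  filter_upwards [self_mem_nhdsWithin] with h hh
  have hh' : h ≠ 0 := hh
  rw [smul_eq_mul]
  field_simp

end

/-! ### Continuous versions and difference quotients of the field. -/

noncomputable section

variable {N : ℕ} {Ω : Type*} [MeasurableSpace Ω] {μ : Measure Ω}
  {X : EuclideanSpace ℝ (Fin N) → Ω → ℝ} {f : EuclideanSpace ℝ (Fin N) → ℝ} {γ : ℝ}
  {β : Fin N → ℝ}

lemma exists_small_exponent {η b : ℝ} (hη : 0 < η) (hb : 0 ≤ b) :
    ∃ a : ℝ, 0 < a ∧ a ≤ 1 ∧ b * (2 * a) < η := by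
  refine ⟨min 1 (η / (2 * (b + 1))), by positivity, min_le_left _ _, ?_⟩
  have h1 : min 1 (η / (2 * (b + 1))) ≤ η / (2 * (b + 1)) := min_le_right _ _
  rw [le_div_iff₀ (by positivity)] at h1
  have h2 : 0 < min 1 (η / (2 * (b + 1))) := by positivity
  nlinarith

lemma exists_norm_rpow_sq_le_gauge_rpow (hβ : ∀ j, 0 < β j) {R a : ℝ} (hR : 0 < R) (ha : 0 < a) :
    ∃ C, 0 ≤ C ∧ ∀ x : EuclideanSpace ℝ (Fin N), R ≤ ‖x‖ →
      (‖x‖ ^ a) ^ 2 ≤ C * gauge β x ^ ((∑ j, 1 / β j) * (2 * a)) := by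
  obtain ⟨C, hC0, hC⟩ := exists_norm_le_gauge_rpow hβ hR
  refine ⟨C ^ (2 * a), by positivity, fun x hx => ?_⟩
  have hS := gauge_nonneg (β := β) x
  calc (‖x‖ ^ a) ^ 2 = ‖x‖ ^ (2 * a) := by
        rw [← Real.rpow_mul_natCast (norm_nonneg x), mul_comm]; norm_num
    _ ≤ (C * gauge β x ^ (∑ j, 1 / β j)) ^ (2 * a) :=
        Real.rpow_le_rpow (norm_nonneg x) (hC x hx) (by positivity)
    _ = _ := by
        rw [Real.mul_rpow hC0 (by positivity), ← Real.rpow_mul hS]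

/-- The minimum supplies the order `‖x‖²` needed near the origin and only the growth `‖x‖^{2a}` at
infinity. -/
lemma ConditionC.exists_integrable_min_norm_rpow (hC : ConditionC f γ β)
    (hf : HasSpectralDensity X μ f) :
    ∃ a : ℝ, 0 < a ∧ a ≤ 1 ∧ Integrable (fun x => (min ‖x‖ (‖x‖ ^ a)) ^ 2)
      (volume.withDensity fun x => ENNReal.ofReal (f x)) := by
  obtain ⟨a, ha, ha1, hab⟩ := exists_small_exponent (sub_pos.2 hC.gamma_gt)
    (Finset.sum_nonneg fun j (_ : j ∈ Finset.univ) => one_div_nonneg.2 (hC.beta_pos j).le)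
  refine ⟨a, ha, ha1, hC.integrable_withDensity hf (by fun_prop) (fun x => sq_nonneg _) hab
    fun R hR => ?_⟩
  obtain ⟨C, hC0, hCb⟩ := exists_norm_rpow_sq_le_gauge_rpow hC.beta_pos hR ha
  refine ⟨max 1 C, by positivity, fun x _ => ?_, fun x hx => ?_⟩
  · calc (min ‖x‖ (‖x‖ ^ a)) ^ 2 ≤ 1 * ‖x‖ ^ 2 := by
          rw [one_mul]; gcongr; exact min_le_left _ _
      _ ≤ _ := by gcongr; exact le_max_left _ _
  · calc (min ‖x‖ (‖x‖ ^ a)) ^ 2 ≤ (‖x‖ ^ a) ^ 2 := by gcongr; exact min_le_right _ _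
      _ ≤ _ := hCb x hx
      _ ≤ _ := by
          have := gauge_nonneg (β := β) x
          gcongr
          exact le_max_right _ _

lemma ConditionC.exists_integrable_coord_mul_norm_rpow (hC : ConditionC f γ β)
    (hf : HasSpectralDensity X μ f) {j : Fin N} (hj : 1 < smoothnessIndex γ β j) :
    ∃ a : ℝ, 0 < a ∧ a ≤ 1 ∧ Integrable (fun x => (|x j| * ‖x‖ ^ a) ^ 2)
      (volume.withDensity fun x => ENNReal.ofReal (f x)) := by
  have hβj := hC.beta_pos j
  -- This is `H_j > 1` rewritten: the room left after spending `2 / β_j` on `|x_j|²`.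
  have hη : 0 < γ - ∑ i, 1 / β i - 1 / β j * 2 := by
    unfold smoothnessIndex at hj
    rw [sub_pos, one_div, ← div_eq_inv_mul, div_lt_iff₀ hβj]
    linarith
  obtain ⟨a, ha, ha1, hab⟩ := exists_small_exponent hη
    (Finset.sum_nonneg fun j (_ : j ∈ Finset.univ) => one_div_nonneg.2 (hC.beta_pos j).le)
  refine ⟨a, ha, ha1, hC.integrable_withDensity hf (by fun_prop) (fun x => sq_nonneg _)
    (κ := 1 / β j * 2 + (∑ i, 1 / β i) * (2 * a)) (by linarith) fun R hR => ?_⟩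
  obtain ⟨C, hC0, hCb⟩ := exists_norm_rpow_sq_le_gauge_rpow hC.beta_pos hR ha
  obtain ⟨c, hc, hcb⟩ := exists_pos_le_gauge hC.beta_pos hR
  refine ⟨max ((R ^ a) ^ 2) C, by positivity, fun x hx => ?_, fun x hx => ?_⟩
  · have hxj : |x j| ≤ ‖x‖ := PiLp.norm_apply_le x j
    calc (|x j| * ‖x‖ ^ a) ^ 2 ≤ (‖x‖ * R ^ a) ^ 2 := by gcongr
      _ = (R ^ a) ^ 2 * ‖x‖ ^ 2 := by ring
      _ ≤ _ := by gcongr; exact le_max_left _ _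
  · have hS : 0 < gauge β x := hc.trans_le (hcb x hx)
    have h1 : |x j| ^ 2 ≤ gauge β x ^ (1 / β j * 2) := by
      calc |x j| ^ 2 ≤ (gauge β x ^ (1 / β j)) ^ 2 := by
            gcongr; exact abs_le_gauge_rpow hC.beta_pos x j
        _ = _ := by rw [← Real.rpow_mul_natCast hS.le]; norm_num
    calc (|x j| * ‖x‖ ^ a) ^ 2 = |x j| ^ 2 * (‖x‖ ^ a) ^ 2 := mul_pow _ _ _
      _ ≤ gauge β x ^ (1 / β j * 2) * (C * gauge β x ^ ((∑ i, 1 / β i) * (2 * a))) :=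
          mul_le_mul h1 (hCb x hx) (by positivity) (by positivity)
      _ = C * gauge β x ^ (1 / β j * 2 + (∑ i, 1 / β i) * (2 * a)) := by
          rw [Real.rpow_add hS]; ring
      _ ≤ _ := by gcongr; exact le_max_right _ _

lemma norm_toLp_sub_le (x y : Fin N → ℝ) :
    ‖WithLp.toLp 2 x - WithLp.toLp 2 y‖ ≤ N * dist x y := by
  refine (norm_le_sum_abs _).trans ?_
  calc ∑ j, |(WithLp.toLp 2 x - WithLp.toLp 2 y) j| ≤ ∑ _j : Fin N, dist x y :=
        Finset.sum_le_sum fun j _ => dist_le_pi_dist x y j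
    _ = N * dist x y := by simp

/-- Under Condition (C) the field has a version with continuous sample functions. -/
theorem exists_continuous_version (hX : IsGaussianProcess X μ) (h0 : ∀ t, ∫ ω, X t ω ∂μ = 0)
    (hf : HasSpectralDensity X μ f) (hC : ConditionC f γ β) :
    ∃ Y : EuclideanSpace ℝ (Fin N) → Ω → ℝ, IsVersion Y X μ ∧
      ∀ ω, Continuous fun t => Y t ω := by
  obtain ⟨a, ha, ha1, hint⟩ := hC.exists_integrable_min_norm_rpow hf
  have hcomb : ∀ x y : Fin N → ℝ, ∀ ω, X (WithLp.toLp 2 x) ω - X (WithLp.toLp 2 y) ω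
      = ∑ i, (![1, -1] : Fin 2 → ℝ) i * X (![WithLp.toLp 2 x, WithLp.toLp 2 y] i) ω := by
    intro x y ω
    simp [Fin.sum_univ_two, sub_eq_add_neg]
  obtain ⟨W, hWm, hWc, hWX⟩ := exists_continuous_modification_of_gaussian (μ := μ)
    (V := fun x => X (WithLp.toLp 2 x)) (A := Set.univ)
    (fun x _ => hX.aemeasurable _) (fun _ _ => Set.mem_univ _)
    (fun x _ y _ => by
      simp_rw [hcomb x y]
      exact hasGaussianLaw_linear_combination hX _ _)
    (fun x _ y _ => by
      simp_rw [hcomb x y]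
      exact integral_linear_combination_eq_zero hX h0 _ _)
    (K := √(∫ x, (min ‖x‖ (‖x‖ ^ a)) ^ 2 ∂(volume.withDensity fun x => ENNReal.ofReal (f x)))
      * (2 * (N + 1))) ha
    (fun x _ y _ hxy => by
      simp_rw [hcomb x y]
      rw [mul_assoc]
      refine hf.spectral.integral_sum_sq_le hX _ _ hint fun l => ?_
      -- The coefficients sum to zero, so the constants `-1` in the kernels cancel.
      have hk : ∑ i, ((![1, -1] : Fin 2 → ℝ) i : ℂ)
          * spectralKernel (![WithLp.toLp 2 x, WithLp.toLp 2 y] i) l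
          = Complex.exp (Complex.I * (inner ℝ (WithLp.toLp 2 x) l : ℝ))
            - Complex.exp (Complex.I * (inner ℝ (WithLp.toLp 2 y) l : ℝ)) := by
        simp [Fin.sum_univ_two, spectralKernel]
      rw [hk]
      set ρ := dist x y
      have hρ : 0 ≤ ρ := dist_nonneg
      have hN : (0 : ℝ) ≤ N := N.cast_nonneg
      have hin : |inner ℝ (WithLp.toLp 2 x) l - inner ℝ (WithLp.toLp 2 y) l|
          ≤ (N + 1) * ρ * ‖l‖ := by
        rw [← inner_sub_left]
        refine (abs_real_inner_le_norm _ _).trans ?_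
        gcongr
        exact (norm_toLp_sub_le x y).trans (by gcongr; linarith)
      have hρa : ρ ≤ ρ ^ a := Real.self_le_rpow_of_le_one hρ hxy ha1
      have e1 := (norm_exp_I_mul_sub_exp_I_mul_le _ _).trans hin
      have e2 := (norm_exp_I_mul_sub_exp_I_mul_le_rpow _ _ ha ha1).trans
        (mul_le_mul_of_nonneg_left (Real.rpow_le_rpow (abs_nonneg _) hin ha.le) zero_le_two)
      rw [mul_min_of_nonneg _ _ (by positivity)]
      refine le_min (e1.trans ?_) (e2.trans ?_)
      · calc (N + 1) * ρ * ‖l‖ ≤ (N + 1) * ρ ^ a * ‖l‖ := by gcongr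
          _ ≤ 2 * (N + 1) * ρ ^ a * ‖l‖ := by
              have : 0 ≤ (N + 1) * ρ ^ a * ‖l‖ := by positivity
              linarith
      · have : ((N : ℝ) + 1) ^ a ≤ N + 1 := by
          simpa using Real.rpow_le_rpow_of_exponent_le (by linarith : (1 : ℝ) ≤ N + 1) ha1
        calc 2 * ((N + 1) * ρ * ‖l‖) ^ a = 2 * (N + 1) ^ a * ρ ^ a * ‖l‖ ^ a := by
              rw [Real.mul_rpow (by positivity) (norm_nonneg l), Real.mul_rpow (by positivity) hρ]
              ring
          _ ≤ 2 * (N + 1) * ρ ^ a * ‖l‖ ^ a := by gcongr)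
  refine ⟨fun t => W (WithLp.ofLp t), ⟨fun t => hWm _, fun t => ?_⟩, fun ω => ?_⟩
  · exact hWX (WithLp.ofLp t) (Set.mem_univ _)
  · exact (hWc ω).comp (by fun_prop)

/-- The point `t ∈ ℝ^N` encoded in the last coordinates of `y ∈ ℝ^(N+1)`. -/
def basePoint (y : Fin (N + 1) → ℝ) : EuclideanSpace ℝ (Fin N) := WithLp.toLp 2 (Fin.tail y)

/-- The step encoded in the first coordinate of `y ∈ ℝ^(N+1)`; it is nonzero on dyadic points. -/
def stepSize (y : Fin (N + 1) → ℝ) : ℝ := y 0 + 1 / 3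

/-- The shift by `1/3` keeps dyadic points off the step `0`, where the quotient is undefined: a zero
would make `3` divide `2 ^ n`. -/
lemma stepSize_gridPoint_ne_zero (n : ℕ) (k : Fin (N + 1) → ℤ) : stepSize (gridPoint n k) ≠ 0 := by
  intro h
  have h2 : (2 : ℝ) ^ n ≠ 0 := by positivity
  simp only [stepSize, gridPoint] at h
  field_simp at h
  have h3 : 3 * k 0 + 2 ^ n = 0 := by
    have : ((3 * k 0 + 2 ^ n : ℤ) : ℝ) = 0 := by push_cast; linarith
    exact_mod_cast this
  have h4 : (3 : ℤ) ∣ 2 ^ n := ⟨-k 0, by linarith⟩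
  have h5 := Int.prime_three.dvd_of_dvd_pow h4
  norm_num at h5

lemma norm_basePoint_sub_le (x y : Fin (N + 1) → ℝ) :
    ‖basePoint x - basePoint y‖ ≤ N * dist x y := by
  refine (norm_toLp_sub_le _ _).trans ?_
  gcongr
  exact (dist_pi_le_iff dist_nonneg).2 fun i => dist_le_pi_dist x y i.succ

lemma abs_stepSize_sub_le (x y : Fin (N + 1) → ℝ) : |stepSize x - stepSize y| ≤ dist x y := by
  have := dist_le_pi_dist x y 0
  rwa [Real.dist_eq, ← add_sub_add_right_eq_sub (x 0) (y 0) (1 / 3)] at this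

/-- If `H_j > 1`, the difference quotients in direction `j` of a continuous version extend
continuously to step zero. -/
theorem ae_exists_hasContinuousQuotient (hX : IsGaussianProcess X μ)
    (h0 : ∀ t, ∫ ω, X t ω ∂μ = 0)
    (hf : HasSpectralDensity X μ f) (hC : ConditionC f γ β) {j : Fin N}
    (hj : 1 < smoothnessIndex γ β j) {Y : EuclideanSpace ℝ (Fin N) → Ω → ℝ}
    (hY : IsVersion Y X μ) (hYc : ∀ ω, Continuous fun t => Y t ω) :
    ∀ᵐ ω ∂μ, ∃ D, HasContinuousQuotient (fun t => Y t ω) j D := by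
  obtain ⟨a, ha, ha1, hint⟩ := hC.exists_integrable_coord_mul_norm_rpow hf hj
  set e : EuclideanSpace ℝ (Fin N) := EuclideanSpace.single j (1 : ℝ) with he
  set V : (Fin (N + 1) → ℝ) → Ω → ℝ := fun y ω =>
    (X (basePoint y + stepSize y • e) ω - X (basePoint y) ω) / stepSize y with hV
  have hcomb : ∀ x y : Fin (N + 1) → ℝ, ∀ ω, V x ω - V y ω
      = ∑ i, (![(stepSize x)⁻¹, -(stepSize x)⁻¹, -(stepSize y)⁻¹, (stepSize y)⁻¹] : Fin 4 → ℝ) i *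
        X (![basePoint x + stepSize x • e, basePoint x, basePoint y + stepSize y • e,
          basePoint y] i) ω := by
    intro x y ω
    simp [Fin.sum_univ_four, hV]
    ring
  obtain ⟨W, hWm, hWc, hWV⟩ := exists_continuous_modification_of_gaussian (μ := μ)
    (V := V) (A := {y | stepSize y ≠ 0})
    (fun x _ => ((hX.aemeasurable _).sub (hX.aemeasurable _)).div_const _)
    stepSize_gridPoint_ne_zero
    (fun x _ y _ => by
      simp_rw [hcomb x y]
      exact hasGaussianLaw_linear_combination hX _ _)
    (fun x _ y _ => by
      simp_rw [hcomb x y]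
      exact integral_linear_combination_eq_zero hX h0 _ _)
    (K := √(∫ x, (|x j| * ‖x‖ ^ a) ^ 2 ∂(volume.withDensity fun x => ENNReal.ofReal (f x)))
      * (2 * (N + 1) ^ a)) ha
    (fun x hx y hy hxy => by
      simp_rw [hcomb x y]
      rw [mul_assoc]
      refine hf.spectral.integral_sum_sq_le hX _ _ hint fun l => ?_
      have hinner : ∀ t : EuclideanSpace ℝ (Fin N), ∀ h : ℝ,
          inner ℝ (t + h • e) l = inner ℝ t l + h * l j := by
        intro t h
        rw [inner_add_left, real_inner_smul_left, he, EuclideanSpace.inner_single_left]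
        simp
      have hk : ∑ i, ((![(stepSize x)⁻¹, -(stepSize x)⁻¹, -(stepSize y)⁻¹, (stepSize y)⁻¹] :
            Fin 4 → ℝ) i : ℂ) * spectralKernel (![basePoint x + stepSize x • e, basePoint x,
              basePoint y + stepSize y • e, basePoint y] i) l
          = (Complex.exp (Complex.I * (inner ℝ (basePoint x) l + stepSize x * l j : ℝ))
              - Complex.exp (Complex.I * (inner ℝ (basePoint x) l : ℝ))) / stepSize x
            - (Complex.exp (Complex.I * (inner ℝ (basePoint y) l + stepSize y * l j : ℝ))
              - Complex.exp (Complex.I * (inner ℝ (basePoint y) l : ℝ))) / stepSize y := by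
        rw [Fin.sum_univ_four]
        simp only [spectralKernel, Matrix.cons_val, hinner]
        push_cast
        ring
      rw [hk]
      refine (norm_exp_difference_quotient_sub_le _ _ _ hx hy ha ha1).trans ?_
      set ρ := dist x y
      have hρ : 0 ≤ ρ := dist_nonneg
      have hlj : |l j| ≤ ‖l‖ := PiLp.norm_apply_le l j
      have hb : |inner ℝ (basePoint x) l - inner ℝ (basePoint y) l|
          + |stepSize x - stepSize y| * |l j| ≤ (N + 1) * ρ * ‖l‖ := by
        have b1 : |inner ℝ (basePoint x) l - inner ℝ (basePoint y) l| ≤ N * ρ * ‖l‖ := by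
          rw [← inner_sub_left]
          exact (abs_real_inner_le_norm _ _).trans
            (mul_le_mul_of_nonneg_right (norm_basePoint_sub_le x y) (norm_nonneg l))
        have b2 : |stepSize x - stepSize y| * |l j| ≤ ρ * ‖l‖ :=
          mul_le_mul (abs_stepSize_sub_le x y) hlj (abs_nonneg _) hρ
        linarith
      calc 2 * |l j| * _ ≤ 2 * |l j| * ((N + 1) * ρ * ‖l‖) ^ a := by gcongr
        _ = _ := by
          rw [Real.mul_rpow (by positivity) (norm_nonneg l), Real.mul_rpow (by positivity) hρ]
          ring)
  -- Decodes `(t, h)` into shifted coordinates; `W ∘ y` is defined and continuous at `h = 0` as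
  -- well.
  set y : EuclideanSpace ℝ (Fin N) × ℝ → Fin (N + 1) → ℝ :=
    fun p => Fin.cons (p.2 - 1 / 3) (WithLp.ofLp p.1) with hy
  have hyc : Continuous y := by
    refine continuous_pi fun i => ?_
    refine Fin.cases ?_ (fun i => ?_) i
    · simp only [hy, Fin.cons_zero]; fun_prop
    · simp only [hy, Fin.cons_succ]; fun_prop
  have hstep : ∀ p, stepSize (y p) = p.2 := fun p => by simp [stepSize, hy]
  have hbase : ∀ p, basePoint (y p) = p.1 := fun p => by
    simp [basePoint, hy]
  have hpt : ∀ p : EuclideanSpace ℝ (Fin N) × ℝ,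
      ∀ᵐ ω ∂μ, Y (p.1 + p.2 • e) ω - Y p.1 ω = p.2 * W (y p) ω := by
    intro p
    by_cases hp : p.2 = 0
    · simp [hp]
    · filter_upwards [hY.2 (p.1 + p.2 • e), hY.2 p.1, hWV (y p) (by simpa [hstep] using hp)]
        with ω e1 e2 e3
      rw [e1, e2, e3]
      simp only [hV, hstep, hbase]
      field_simp
  -- Countability gives one null set for all points of `S`; both sides being continuous in `(t, h)`,
  -- density gives the identity everywhere.
  obtain ⟨S, hSc, hSd⟩ := TopologicalSpace.exists_countable_dense (EuclideanSpace ℝ (Fin N) × ℝ)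
  filter_upwards [(ae_ball_iff hSc).2 fun p _ => hpt p] with ω hω
  refine ⟨fun p => W (y p) ω, (hWc ω).comp hyc, fun t h => ?_⟩
  have heq : (fun p : EuclideanSpace ℝ (Fin N) × ℝ => Y (p.1 + p.2 • e) ω - Y p.1 ω)
      = fun p => p.2 * W (y p) ω := by
    refine Continuous.ext_on hSd ?_ (continuous_snd.mul ((hWc ω).comp hyc)) fun p hp => hω p hp
    exact ((hYc ω).comp (by fun_prop)).sub ((hYc ω).comp continuous_fst)
  exact congrFun heq (t, h)

end

end AnisotropicField

theorem theorem4p8 {N : ℕ} {Ω : Type*} [MeasurableSpace Ω] (μ : Measure Ω)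
    [IsProbabilityMeasure μ] (X : EuclideanSpace ℝ (Fin N) → Ω → ℝ)
    (hGauss : IsGaussianProcess X μ)
    (hCentered : ∀ t, ∫ ω, X t ω ∂μ = 0)
    (hZero : ∀ᵐ ω ∂μ, X 0 ω = 0)
    (hIncr : AnisotropicField.HasStationaryIncrements X μ)
    (f : EuclideanSpace ℝ (Fin N) → ℝ)
    (hDensity : AnisotropicField.HasSpectralDensity X μ f)
    (γ : ℝ) (β : Fin N → ℝ) (hC : AnisotropicField.ConditionC f γ β) :
    (∀ j : Fin N, 1 < AnisotropicField.smoothnessIndex γ β j →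
      ∃ Y : EuclideanSpace ℝ (Fin N) → Ω → ℝ, AnisotropicField.IsVersion Y X μ ∧
        (∀ ω, Continuous fun t => Y t ω) ∧
        ∀ᵐ ω ∂μ,
          (∀ t, AnisotropicField.HasPartial (fun s => Y s ω) j t) ∧
          Continuous fun t => AnisotropicField.partialDeriv (fun s => Y s ω) j t) ∧
    ((∀ j : Fin N, 1 < AnisotropicField.smoothnessIndex γ β j) →
      ∃ Y : EuclideanSpace ℝ (Fin N) → Ω → ℝ, AnisotropicField.IsVersion Y X μ ∧
        ∀ᵐ ω ∂μ,
          ContDiff ℝ 1 (fun t => Y t ω) ∧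
          ∀ u t : EuclideanSpace ℝ (Fin N), ‖u‖ = 1 →
            Tendsto
              (fun h : ℝ => (Y (t + h • u) ω - Y t ω -
                h * inner ℝ u (AnisotropicField.grad (fun s => Y s ω) t)) / h)
              (𝓝[≠] 0) (𝓝 0)) := by
  -- One continuous version serves both claims and every direction `j`.
  obtain ⟨Y, hY, hYc⟩ :=
    AnisotropicField.exists_continuous_version hGauss hCentered hDensity hC
  refine ⟨fun j hj => ⟨Y, hY, hYc, ?_⟩, fun hall => ⟨Y, hY, ?_⟩⟩
  · filter_upwards [AnisotropicField.ae_exists_hasContinuousQuotient hGauss hCentered hDensity hC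
      hj hY hYc] with ω ⟨D, hD⟩
    refine ⟨fun t => (hD.hasLineDerivAt t).lineDifferentiableAt, ?_⟩
    have : (fun t => AnisotropicField.partialDeriv (fun s => Y s ω) j t) = fun t => D (t, 0) :=
      funext fun t => (hD.hasLineDerivAt t).lineDeriv
    rw [this]
    exact hD.1.comp (by fun_prop)
  · filter_upwards [ae_all_iff.2 fun j => AnisotropicField.ae_exists_hasContinuousQuotient hGauss
      hCentered hDensity hC (hall j) hY hYc] with ω hω
    choose D hD using hω
    have hcd := AnisotropicField.contDiff_one_of_hasContinuousQuotient hD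
    exact ⟨hcd, fun u t _ => AnisotropicField.tendsto_directional_remainder
      (hcd.differentiable one_ne_zero t) u⟩
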